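/- Let $n\ge 3$. There is a fast $n$-ring $(J_i,f_i)_{i\in\mathbf Z/n}$ on the circle $\mathbf S^1=\mathbf R/\mathbf Z$ such that the derived subgroup $H_n=G_n'$ of the group $G_n=\langle f_1,\dots,f_n\rangle\le \mathrm{Homeo}(\mathbf S^1)$ is finitely generated, simple and left orderable, and admits an action on $\mathbf R$ by orientation-preserving homeomorphisms which is of type (ii). In particular, there exist finitely generated simple left orderable groups which admit actions of type (ii) on the real line. Here a *fast $n$-ring* consists of connected open nonempty subsets $J_i\subset\mathbf S^1$ ($i\in\mathbf Z/n$) covering $\mathbf S^1$ and homeomorphisms $f_i$ of $\mathbf S^1$ such that: $J_i=\{x\in\mathbf S^1: f_i(x)\ne x\}$ for all $i$; $J_i\cap J_j=\emptyset$ if $j\notin\{i-1,i,i+1\}$; $J_i\cap J_{i+1}$ is nonempty, connected and properly contained in both $J_i$ and $J_{i+1}$; and, if $x$ is the endpoint of $J_{i+1}$ that lies in $J_i$, then for every $1\le l\le n$ the image of $x$ under first $f_i$, then $f_{i+1}$, and so on up to $f_{i+l}$, lies in $J_{i+l+1}$. An action of a group $G$ on $\mathbf R$ by orientation-preserving homeomorphisms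 is *of type (ii)* if it has no global fixed point and is semiconjugate (through a continuous nondecreasing surjection $\Phi:\mathbf R\to\mathbf R$ intertwining the two actions) to an action of $G$ on $\mathbf R$ by orientation-preserving homeomorphisms such that all orbits are dense, there is $\varepsilon>0$ such that every interval $[a,b]$ of length less than $\varepsilon$ is contracted, and some bounded interval is not contracted; $[a,b]$ is *contracted* if there are $g_k\in G$ such that the intervals $g_k([a,b])$ converge to a point of $\mathbf R$ as $k\to\infty$. -/

import Mathlib

open Filter Topology Set

namespace LineAction

/-- A group is left orderable if it carries a total order invariant under left multiplication. -/
def IsLeftOrderable (G : Type*) [Group G] : Prop :=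
  ∃ r : LinearOrder G, ∀ a b c : G, r.lt b c → r.lt (a * b) (a * c)

/-! ### Actions on the real line

An action of `G` on the line by homeomorphisms is a homomorphism `ρ : G →* (ℝ ≃ₜ ℝ)`. -/

section Actions

variable {G : Type*} [Group G]

/-- Every group element acts by an orientation preserving (increasing) homeomorphism. -/
def IsOrientationPreserving (ρ : G →* (ℝ ≃ₜ ℝ)) : Prop :=
  ∀ g : G, StrictMono (ρ g)

/-- No point of the line is fixed by the whole group. -/
def HasNoGlobalFixedPoint (ρ : G →* (ℝ ≃ₜ ℝ)) : Prop :=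
  ∀ x : ℝ, ∃ g : G, ρ g x ≠ x

/-- All orbits are dense. -/
def IsMinimalAction (ρ : G →* (ℝ ≃ₜ ℝ)) : Prop :=
  ∀ x : ℝ, Dense (range fun g : G => ρ g x)

/-- `ρ` is semiconjugate to `σ`: some continuous, nondecreasing, surjective map of the line
intertwines `ρ` with `σ`. -/
def IsSemiconjugateTo (ρ σ : G →* (ℝ ≃ₜ ℝ)) : Prop :=
  ∃ Φ : ℝ → ℝ, Continuous Φ ∧ Monotone Φ ∧ Function.Surjective Φ ∧
    ∀ (g : G) (x : ℝ), Φ (ρ g x) = σ g (Φ x)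

/-- The interval `[a, b]` is contracted: along some sequence of group elements, its images
converge to a point of the line. -/
def IsContracted (ρ : G →* (ℝ ≃ₜ ℝ)) (a b : ℝ) : Prop :=
  ∃ (g : ℕ → G) (p : ℝ), ∀ U ∈ 𝓝 p, ∀ᶠ k in atTop, ρ (g k) '' Icc a b ⊆ U

/-- Every small enough interval is contracted. -/
def IsLocallyContracting (ρ : G →* (ℝ ≃ₜ ℝ)) : Prop :=
  ∃ ε : ℝ, 0 < ε ∧ ∀ a b : ℝ, a < b → b - a < ε → IsContracted ρ a b

/-- Every bounded interval is contracted. -/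
def IsGloballyContracting (ρ : G →* (ℝ ≃ₜ ℝ)) : Prop :=
  ∀ a b : ℝ, a < b → IsContracted ρ a b

/-- The second alternative of the trichotomy: an orientation preserving action without global
fixed points which is semiconjugate to a minimal (orientation preserving) action that is locally,
but not globally, contracting. -/
def IsTypeTwo (ρ : G →* (ℝ ≃ₜ ℝ)) : Prop :=
  IsOrientationPreserving ρ ∧ HasNoGlobalFixedPoint ρ ∧
    ∃ σ : G →* (ℝ ≃ₜ ℝ), IsOrientationPreserving σ ∧ IsSemiconjugateTo ρ σ ∧
      IsMinimalAction σ ∧ IsLocallyContracting σ ∧ ¬ IsGloballyContracting σ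

end Actions

/-! ### Fast ring groups of circle homeomorphisms

The circle is `ℝ / ℤ`, that is `UnitAddCircle`. Indices are taken modulo `n`. -/

/-- An `n`-ring of intervals `J i` and homeomorphisms `f i` of the circle. -/
structure IsRing (n : ℕ) (J : ZMod n → Set UnitAddCircle)
    (f : ZMod n → (UnitAddCircle ≃ₜ UnitAddCircle)) : Prop where
  /-- the `J i` are open -/
  isOpen : ∀ i, IsOpen (J i)
  /-- the `J i` are nonempty and connected -/
  isConnected : ∀ i, IsConnected (J i)
  /-- the `J i` cover the circle -/
  cover : ⋃ i, J i = univ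
  /-- intervals with non-adjacent indices are disjoint -/
  disjoint : ∀ i j, j ≠ i → j ≠ i + 1 → i ≠ j + 1 → Disjoint (J i) (J j)
  /-- intervals with adjacent indices meet in a nonempty connected set, -/
  inter_connected : ∀ i, IsConnected (J i ∩ J (i + 1))
  /-- which is properly contained in both -/
  inter_proper : ∀ i, J i ∩ J (i + 1) ⊂ J i ∧ J i ∩ J (i + 1) ⊂ J (i + 1)
  /-- `J i` is the support of `f i` -/
  support : ∀ i, J i = {x | f i x ≠ x}

/-- `track f i x l` is the image of `x` under first `f i`, then `f (i + 1)`, and so on up to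
`f (i + l)`. -/
def track {n : ℕ} (f : ZMod n → (UnitAddCircle ≃ₜ UnitAddCircle)) (i : ZMod n)
    (x : UnitAddCircle) : ℕ → UnitAddCircle
  | 0 => f i x
  | l + 1 => f (i + (l + 1 : ℕ)) (track f i x l)

/-- A fast `n`-ring: an `n`-ring such that the endpoint `x` of `J (i + 1)` lying in `J i` is moved
into `J (i + l + 1)` by `f i`, `f (i + 1)`, …, `f (i + l)` applied in this order,
for `1 ≤ l ≤ n`. -/
def IsFastRing (n : ℕ) (J : ZMod n → Set UnitAddCircle)
    (f : ZMod n → (UnitAddCircle ≃ₜ UnitAddCircle)) : Prop :=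
  IsRing n J f ∧
    ∀ i, ∀ x ∈ J i ∩ frontier (J (i + 1)), ∀ l : ℕ, 1 ≤ l → l ≤ n →
      track f i x l ∈ J (i + (l : ZMod n) + 1)

/-- The group of circle homeomorphisms generated by the `f i`. -/
abbrev ringGroup {n : ℕ} (f : ZMod n → (UnitAddCircle ≃ₜ UnitAddCircle)) :
    Subgroup (UnitAddCircle ≃ₜ UnitAddCircle) :=
  Subgroup.closure (range f)

/-- The derived subgroup of the group generated by the `f i`. -/
abbrev ringDerivedGroup {n : ℕ} (f : ZMod n → (UnitAddCircle ≃ₜ UnitAddCircle)) :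
    Subgroup (ringGroup f) :=
  commutator (ringGroup f)

end LineAction

/-! Take the circle to be the line modulo `2 n`, and let generator number `k` be a bump supported on
`(2 k, 2 k + 4)`. It stretches `[2 k, 2 k + 1]` threefold onto `[2 k, 2 k + 3]` and shrinks `[2 k +
1, 2 k + 4]` onto `[2 k + 3, 2 k + 4]`. So everything in the support beyond the left foot `(2 k, 2 k
+ 1)` goes to the right foot, up to endpoints. The feet of all bumps are the gaps between
consecutive integers, hence disjoint, and each right foot lies in the contracted zone of the next
bump; this gives fastness.

The bumps lift to homeomorphisms of the line commuting with translation by `2 n`. The crux is that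
the lifted group contains no nontrivial translation by a multiple of `2 n`: by ping-pong, the orbit
of `0` contains no other integer (`Reached`, `eq_zero_of_translation`). Hence the ring group is
isomorphic to its lift (`liftToCircle_injective`) and acts faithfully on the line, which makes it
and its derived subgroup left orderable.

The expansion at the feet carries any interval to one containing an even integer, and with pushes by
successive bumps every interval shorter than the period can be moved into any open interval
(`exists_compress`). Correcting by an element that fixes the compressed interval pointwise gives the
same for the derived subgroup (`exists_compress_derived`). Its line action is therefore minimal and
locally contracting; periodicity prevents an interval of length `2 n` from being contracted.

On the circle, compression yields finite generation by replacing conjugation by a generator with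
conjugation by an element of the derived subgroup (`fg_commutator_of_isCompressing`). For
simplicity, a double commutator argument puts all local commutators into every nontrivial normal
subgroup of the derived subgroup (`localCommutator_le`). Local commutators give the whole derived
subgroup because adjacent generators satisfy relations of Thompson's group and therefore commute
modulo them (`ringGen_commutator_succ`). -/

namespace RingGroup

open scoped commutatorElement

/-! ### Commutator identities in abstract groups -/

section GroupLemmas

variable {G ι : Type*} [Group G]

/-- If generators of `G` commute modulo a normal subgroup, it contains the derived subgroup. -/
theorem commutator_le_of_generators_commute {f : ι → G}
    (hgen : Subgroup.closure (range f) = ⊤) (N : Subgroup G) [N.Normal]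
    (h : ∀ i j, ⁅f i, f j⁆ ∈ N) : commutator G ≤ N := by
  have hle : Subgroup.map (QuotientGroup.mk' N) (commutator G) = ⊥ := by
    have hcomm : ∀ x y : G, Commute (x : G ⧸ N) (y : G ⧸ N) := by
      have h1 : ∀ i, ∀ y : G, Commute (f i : G ⧸ N) (y : G ⧸ N) := by
        intro i y
        have hy : y ∈ Subgroup.closure (range f) := hgen ▸ Subgroup.mem_top y
        induction hy using Subgroup.closure_induction with
        | mem y hy =>
          obtain ⟨j, rfl⟩ := hy
          have := (QuotientGroup.eq_one_iff _).2 (h i j)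
          exact commutatorElement_eq_one_iff_commute.1 this
        | one => exact Commute.one_right _
        | mul a b _ _ ha hb => exact ha.mul_right hb
        | inv a _ ha => exact ha.inv_right
      intro x y
      have hx : x ∈ Subgroup.closure (range f) := hgen ▸ Subgroup.mem_top x
      induction hx using Subgroup.closure_induction with
      | mem x hx => obtain ⟨j, rfl⟩ := hx; exact h1 j y
      | one => exact Commute.one_left _
      | mul a b _ _ ha hb => exact ha.mul_left hb
      | inv a _ ha => exact ha.inv_left
    rw [commutator_def, Subgroup.map_commutator, eq_bot_iff, Subgroup.commutator_le]
    rintro _ ⟨x, -, rfl⟩ _ ⟨y, -, rfl⟩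
    rw [Subgroup.mem_bot, commutatorElement_eq_one_iff_commute]
    exact hcomm x y
  rwa [Subgroup.map_eq_bot_iff, QuotientGroup.ker_mk'] at hle

theorem conj_mul_inv_mem_commutator (g t : G) : g * (t * g⁻¹ * t⁻¹) ∈ commutator G := by
  have : g * (t * g⁻¹ * t⁻¹) = ⁅g, t⁆ := by rw [commutatorElement_def]; group
  rw [this, commutator_def]
  exact Subgroup.commutator_mem_commutator (Subgroup.mem_top _) (Subgroup.mem_top _)

/-- If a subgroup contains a conjugate of every generator, its cosets all meet the derived
subgroup. -/
theorem exists_mul_mem_commutator {f : ι → G} (hgen : Subgroup.closure (range f) = ⊤)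
    (W : Subgroup G) (hW : ∀ i, ∃ r : G, r * f i * r⁻¹ ∈ W) (g : G) :
    ∃ w ∈ W, w * g ∈ commutator G := by
  have htop : W ⊔ commutator G = ⊤ := by
    rw [eq_top_iff, ← hgen, Subgroup.closure_le]
    rintro _ ⟨i, rfl⟩
    obtain ⟨r, hr⟩ := hW i
    have h2 := conj_mul_inv_mem_commutator (f i) r
    have h3 : f i = (f i * (r * (f i)⁻¹ * r⁻¹)) * (r * f i * r⁻¹) := by group
    rw [h3]
    exact mul_mem (Subgroup.mem_sup_right h2) (Subgroup.mem_sup_left hr)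
  have hg : g ∈ W ⊔ commutator G := htop ▸ Subgroup.mem_top g
  obtain ⟨w, hw, c, hc, rfl⟩ := Subgroup.mem_sup_of_normal_right.1 hg
  exact ⟨w⁻¹, inv_mem hw, by simpa using hc⟩

/-- A relation pattern of Thompson's group forcing two elements to commute. -/
theorem commute_of_thompson_relations {f g : G}
    (h1 : Commute f (g * (f * g * f⁻¹) * g⁻¹))
    (h2 : Commute f (g * (f * f * g * f⁻¹ * f⁻¹) * g⁻¹))
    (h3 : Commute (g⁻¹ * (f * g * f⁻¹)) (f * (g⁻¹ * (f * g * f⁻¹)) * f⁻¹)) :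
    Commute f g := by
  obtain ⟨g1, hg1⟩ : ∃ g1, g1 = f * g * f⁻¹ := ⟨_, rfl⟩
  obtain ⟨g2, hg2⟩ : ∃ g2, g2 = f * g1 * f⁻¹ := ⟨_, rfl⟩
  obtain ⟨g3, hg3⟩ : ∃ g3, g3 = f * g2 * f⁻¹ := ⟨_, rfl⟩
  have e2 : f * f * g * f⁻¹ * f⁻¹ = g2 := by rw [hg2, hg1]; group
  rw [← hg1] at h1 h3
  rw [e2] at h2
  obtain ⟨d, hd⟩ : ∃ d, d = g⁻¹ * g1 := ⟨_, rfl⟩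
  have e1 : f * (g⁻¹ * g1) * f⁻¹ = g1⁻¹ * g2 := by rw [hg2]; nth_rewrite 2 [hg1]; group
  obtain ⟨d1, hd1⟩ : ∃ d1, d1 = g1⁻¹ * g2 := ⟨_, rfl⟩
  rw [e1, ← hd, ← hd1] at h3
  -- Conjugation by `f` raises the indices of `g`, `g1`, `g2` by one, and by `h1` it fixes `g * g1 *
  -- g⁻¹`.
  have k1 : g1 * g2 * g1⁻¹ = g * g1 * g⁻¹ := by
    have : f * (g * g1 * g⁻¹) * f⁻¹ = g * g1 * g⁻¹ := by rw [h1.eq]; group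
    rw [← this, hg2, hg1]; group
  have k2 : g1 * g3 * g1⁻¹ = g * g2 * g⁻¹ := by
    have : f * (g * g2 * g⁻¹) * f⁻¹ = g * g2 * g⁻¹ := by rw [h2.eq]; group
    rw [← this, hg3, hg1]; group
  have hg1d : g1 = g * d := by rw [hd]; group
  have hg2d : g2 = g1 * d1 := by rw [hd1]; group
  have m1 : g2 = d⁻¹ * g1 * d := by
    have : g2 = g1⁻¹ * (g1 * g2 * g1⁻¹) * g1 := by group
    rw [this, k1, hd]; group
  have m2 : g3 = d⁻¹ * g2 * d := by
    have : g3 = g1⁻¹ * (g1 * g3 * g1⁻¹) * g1 := by group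
    rw [this, k2, hd]; group
  have m3 : g3 = g2 * d1 := by
    rw [m2, hg2d]
    calc d⁻¹ * (g1 * d1) * d = d⁻¹ * g1 * (d1 * d) := by group
      _ = d⁻¹ * g1 * (d * d1) := by rw [h3.eq]
      _ = (d⁻¹ * g1 * d) * d1 := by group
      _ = g1 * d1 * d1 := by rw [← m1, hg2d]
  have m4 : f * d1 * f⁻¹ = d1 := by
    have : f * d1 * f⁻¹ = g2⁻¹ * g3 := by rw [hd1, hg3, hg2]; group
    rw [this, m3]; group
  have m5 : f * d * f⁻¹ = d1 := by rw [hd, e1, hd1]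
  -- Conjugation by `f` sends both `d` and `d1` to `d1`; injectivity identifies them.
  have m6 : d = d1 := by
    have : f * d * f⁻¹ = f * d1 * f⁻¹ := by rw [m4, m5]
    simpa using this
  have m7 : d = 1 := by
    rw [hg2d, ← m6] at m1
    have : d⁻¹ * g1 * d = g1 * d := m1.symm
    have h5 := mul_right_cancel this
    simpa using h5
  have : f * g * f⁻¹ = g := by rw [← hg1, hg1d, m7, mul_one]
  exact mul_inv_eq_iff_eq_mul.1 this

end GroupLemmas

/-! ### Compressing actions: finite generation and simplicity of the derived subgroup -/

section Homeo

variable {X G : Type*} [TopologicalSpace X] [Group G]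

/-- Elements acting trivially on `S`. -/
def fixer (φ : G →* (X ≃ₜ X)) (S : Set X) : Subgroup G where
  carrier := {g | ∀ x ∈ S, φ g x = x}
  one_mem' := fun x _ => by simp
  mul_mem' := fun {a b} ha hb x hx => by
    rw [map_mul, Homeomorph.mul_apply, hb x hx, ha x hx]
  inv_mem' := fun {a} ha x hx => by
    rw [map_inv, Homeomorph.inv_apply, Homeomorph.symm_apply_eq, ha x hx]

variable {φ : G →* (X ≃ₜ X)}

theorem fixer_anti {S T : Set X} (h : S ⊆ T) : fixer φ T ≤ fixer φ S :=
  fun _ hg x hx => hg x (h hx)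

theorem apply_inv_apply (φ : G →* (X ≃ₜ X)) (g : G) (x : X) : φ g (φ g⁻¹ x) = x := by
  rw [map_inv, Homeomorph.inv_apply, Homeomorph.apply_symm_apply]

theorem inv_apply_apply (φ : G →* (X ≃ₜ X)) (g : G) (x : X) : φ g⁻¹ (φ g x) = x := by
  rw [map_inv, Homeomorph.inv_apply, Homeomorph.symm_apply_apply]

theorem conj_mem_fixer {S T : Set X} {g h : G} (hg : g ∈ fixer φ S)
    (hST : ∀ x, x ∉ S → φ h x ∈ T) : h * g * h⁻¹ ∈ fixer φ Tᶜ := by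
  intro x hx
  have hS : φ h⁻¹ x ∈ S := by
    by_contra hc
    exact hx (by simpa only [apply_inv_apply] using hST _ hc)
  rw [map_mul, map_mul, Homeomorph.mul_apply, Homeomorph.mul_apply, hg _ hS, apply_inv_apply]

theorem apply_mem_of_mem_fixer_compl {S : Set X} {g : G} (hg : g ∈ fixer φ Sᶜ) {x : X}
    (hx : x ∈ S) : φ g x ∈ S := by
  by_contra hc
  have h1 := hg _ hc
  have := (φ g).injective h1
  exact hc (this.symm ▸ hx)

theorem commute_of_fixer (hφ : Function.Injective φ) {S T : Set X} {a b : G}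
    (ha : a ∈ fixer φ Sᶜ) (hb : b ∈ fixer φ Tᶜ) (hST : Disjoint S T) : Commute a b := by
  apply hφ
  ext x
  rw [map_mul, map_mul, Homeomorph.mul_apply, Homeomorph.mul_apply]
  by_cases hS : x ∈ S
  · rw [hb x (disjoint_left.1 hST hS),
      hb _ (disjoint_left.1 hST (apply_mem_of_mem_fixer_compl ha hS))]
  · by_cases hT : x ∈ T
    · rw [ha x hS, ha _ (disjoint_right.1 hST (apply_mem_of_mem_fixer_compl hb hT))]
    · rw [ha x hS, hb x hT, ha x hS]

/-- Disjoint nonempty open subsets of finitely many given infinite open sets. -/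
theorem exists_disjoint_open_subsets [T2Space X] {E : Type*} [Finite E] (A : E → Set X)
    (hA : ∀ e, IsOpen (A e)) (hinf : ∀ e, (A e).Infinite) :
    ∃ U : E → Set X, (∀ e, IsOpen (U e)) ∧ (∀ e, (U e).Nonempty) ∧ (∀ e, U e ⊆ A e) ∧
      ∀ e e', e ≠ e' → Disjoint (U e) (U e') := by
  classical
  have := Fintype.ofFinite E
  choose t ht hcard using fun e => (hinf e).exists_subset_card_eq (Fintype.card E)
  -- Hall's theorem selects distinct points: each `t e` already has as many elements as there are
  -- indices.
  obtain ⟨y, hyinj, hy⟩ := (Finset.all_card_le_biUnion_card_iff_exists_injective t).1 (by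
    intro s
    rcases s.eq_empty_or_nonempty with rfl | ⟨e, he⟩
    · simp
    · calc s.card ≤ Fintype.card E := s.card_le_univ
        _ = (t e).card := (hcard e).symm
        _ ≤ _ := Finset.card_le_card (Finset.subset_biUnion_of_mem t he))
  obtain ⟨V, hV, hdisj⟩ := (finite_range y).t2_separation
  refine ⟨fun e => V (y e) ∩ A e, fun e => (hV _).2.inter (hA e),
    fun e => ⟨y e, (hV _).1, ht e (hy e)⟩, fun e => inter_subset_right, fun e e' hne => ?_⟩
  exact (hdisj (mem_range_self e) (mem_range_self e') (hyinj.ne hne)).mono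
    inter_subset_left inter_subset_left

/-- The complement of any nonempty open set can be moved into any nonempty open set. -/
def IsCompressing (φ : G →* (X ≃ₜ X)) : Prop :=
  ∀ U V : Set X, IsOpen U → U.Nonempty → IsOpen V → V.Nonempty →
    ∃ g : G, ∀ x, x ∉ U → φ g x ∈ V

/-- The derived subgroup of a compressing group generated by finitely many homeomorphisms that
are trivial on nonempty open sets is finitely generated. -/
theorem fg_commutator_of_isCompressing [T2Space X] (hφ : Function.Injective φ)
    (hX : ∀ U : Set X, IsOpen U → U.Nonempty → U.Infinite) (hc : IsCompressing φ)
    {ι : Type*} [Finite ι] {f : ι → G} (hgen : Subgroup.closure (range f) = ⊤)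
    (O : ι → Set X) (hO : ∀ i, IsOpen (O i)) (hne : ∀ i, (O i).Nonempty)
    (hf : ∀ i, f i ∈ fixer φ (O i)) : Group.FG (commutator G) := by
  -- The index `(i, j, b)` stands for a conjugate of `f i` supported where `f j` is trivial. The
  -- Boolean supplies a second copy, disjoint from any one already in use.
  obtain ⟨U, hUo, hUne, hUO, hUd⟩ := exists_disjoint_open_subsets (E := ι × ι × Bool)
    (fun e => O e.2.1) (fun e => hO _) (fun e => hX _ (hO _) (hne _))
  choose t ht using fun e : ι × ι × Bool =>
    hc (O e.1) (U e) (hO _) (hne _) (hUo e) (hUne e)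
  set u : ι × ι × Bool → G := fun e => t e * f e.1 * (t e)⁻¹ with hu
  have hfix : ∀ e, u e ∈ fixer φ (U e)ᶜ := fun e => conj_mem_fixer (hf e.1) (ht e)
  have huu : ∀ e e', e ≠ e' → Commute (u e) (u e') := fun e e' h =>
    commute_of_fixer hφ (hfix e) (hfix e') (hUd e e' h)
  have huf : ∀ e, Commute (u e) (f e.2.1) := fun e =>
    commute_of_fixer hφ (hfix e) (T := (O e.2.1)ᶜ) (by simpa using hf e.2.1)
      (disjoint_compl_right_iff_subset.2 (hUO e))
  set S : Set G := range (fun e => f e.1 * (u e)⁻¹) ∪ range (fun e => (f e.1)⁻¹ * u e) with hS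
  set K := Subgroup.closure S with hK
  have hKle : K ≤ commutator G := by
    rw [hK, Subgroup.closure_le]
    rintro _ (⟨e, rfl⟩ | ⟨e, rfl⟩)
    · have := conj_mul_inv_mem_commutator (f e.1) (t e)
      simp only [hu, SetLike.mem_coe]
      convert this using 1
      group
    · have := conj_mul_inv_mem_commutator (f e.1)⁻¹ (t e)
      simp only [hu, SetLike.mem_coe]
      convert this using 1
      group
  -- for every element of `S` and every `i` some `u` conjugate to `f i` commutes with it
  have hcommS : ∀ s ∈ S, ∀ i, ∃ e : ι × ι × Bool, e.1 = i ∧ Commute (u e) s := by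
    have key : ∀ (e' : ι × ι × Bool) (i : ι), ∃ e : ι × ι × Bool, e.1 = i ∧
        Commute (u e) (f e'.1) ∧ Commute (u e) (u e') := by
      intro e' i
      refine ⟨(i, e'.1, !e'.2.2), rfl, huf (i, e'.1, !e'.2.2), huu _ _ fun h => ?_⟩
      have := congrArg (fun z => z.2.2) h
      simp at this
    rintro _ (⟨e', rfl⟩ | ⟨e', rfl⟩) i
    · obtain ⟨e, he, h1, h2⟩ := key e' i
      exact ⟨e, he, h1.mul_right h2.inv_right⟩
    · obtain ⟨e, he, h1, h2⟩ := key e' i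
      exact ⟨e, he, h1.inv_right.mul_right h2⟩
  have hconj : ∀ i, ∀ k ∈ K, f i * k * (f i)⁻¹ ∈ K ∧ (f i)⁻¹ * k * f i ∈ K := by
    intro i k hk
    induction hk using Subgroup.closure_induction with
    | mem s hs =>
      obtain ⟨e, rfl, hes⟩ := hcommS s hs i
      have hsK : s ∈ K := Subgroup.subset_closure hs
      have h1 : f e.1 * (u e)⁻¹ ∈ K := Subgroup.subset_closure (Or.inl ⟨e, rfl⟩)
      have h2 : (f e.1)⁻¹ * u e ∈ K := Subgroup.subset_closure (Or.inr ⟨e, rfl⟩)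
      constructor
      -- Since `u e` commutes with `s`, conjugation by `f e.1` acts on `s` like conjugation by an
      -- element of `K`.
      · have : f e.1 * s * (f e.1)⁻¹ =
            (f e.1 * (u e)⁻¹) * s * (f e.1 * (u e)⁻¹)⁻¹ := by
          calc f e.1 * s * (f e.1)⁻¹ = f e.1 * (u e)⁻¹ * (u e * s) * (f e.1)⁻¹ := by group
            _ = f e.1 * (u e)⁻¹ * (s * u e) * (f e.1)⁻¹ := by rw [hes.eq]
            _ = _ := by group
        rw [this]
        exact mul_mem (mul_mem h1 hsK) (inv_mem h1)
      · have : (f e.1)⁻¹ * s * f e.1 =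
            ((f e.1)⁻¹ * u e) * s * ((f e.1)⁻¹ * u e)⁻¹ := by
          calc (f e.1)⁻¹ * s * f e.1 = (f e.1)⁻¹ * (s * u e) * (u e)⁻¹ * f e.1 := by group
            _ = (f e.1)⁻¹ * (u e * s) * (u e)⁻¹ * f e.1 := by rw [hes.eq]
            _ = _ := by group
        rw [this]
        exact mul_mem (mul_mem h2 hsK) (inv_mem h2)
    | one => simp
    | mul a b _ _ ha hb =>
      constructor
      · have := mul_mem ha.1 hb.1
        convert this using 1
        group
      · have := mul_mem ha.2 hb.2
        convert this using 1
        group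
    | inv a _ ha =>
      constructor
      · have := inv_mem ha.1
        convert this using 1
        group
      · have := inv_mem ha.2
        convert this using 1
        group
  have hnormal : K.Normal := by
    rw [← Subgroup.normalizer_eq_top_iff, eq_top_iff, ← hgen, Subgroup.closure_le]
    rintro _ ⟨i, rfl⟩
    rw [SetLike.mem_coe, Subgroup.mem_normalizer_iff]
    refine fun k => ⟨fun hk => (hconj i k hk).1, fun hk => ?_⟩
    have := (hconj i _ hk).2
    convert this using 1
    group
  have hle : commutator G ≤ K := by
    refine commutator_le_of_generators_commute hgen K fun i j => ?_
    have h1 : f i * (u (i, j, true))⁻¹ ∈ K :=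
      Subgroup.subset_closure (Or.inl ⟨(i, j, true), rfl⟩)
    have hcm := huf (i, j, true)
    set v := u (i, j, true)
    -- As `v` commutes with `f j`, replacing `f i` by `f i * v⁻¹` does not change the commutator.
    have : ⁅f i, f j⁆ = (f i * v⁻¹) * (f j * (f i * v⁻¹)⁻¹ * (f j)⁻¹) := by
      have h2 : v * f j = f j * v := hcm.eq
      rw [commutatorElement_def]
      calc f i * f j * (f i)⁻¹ * (f j)⁻¹
          = f i * v⁻¹ * (v * f j) * (f i)⁻¹ * (f j)⁻¹ := by group
        _ = f i * v⁻¹ * (f j * v) * (f i)⁻¹ * (f j)⁻¹ := by rw [h2]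
        _ = _ := by group
    rw [this]
    exact mul_mem h1 (hnormal.conj_mem _ (inv_mem h1) _)
  have hKeq : K = commutator G := le_antisymm hKle hle
  rw [Group.fg_iff_subgroup_fg, Subgroup.fg_iff]
  exact ⟨S, hKeq, (finite_range _).union (finite_range _)⟩

/-- The subgroup generated by commutators of elements with a common nonempty open set of fixed
points. -/
def localCommutator (φ : G →* (X ≃ₜ X)) : Subgroup G :=
  Subgroup.closure {c | ∃ (O : Set X) (g h : G), IsOpen O ∧ O.Nonempty ∧ g ∈ fixer φ O ∧
    h ∈ fixer φ O ∧ ⁅g, h⁆ = c}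

instance localCommutator_normal : (localCommutator φ).Normal := by
  refine ⟨fun c hc k => ?_⟩
  induction hc using Subgroup.closure_induction with
  | mem c hc =>
    obtain ⟨O, g, h, hO, hne, hg, hh, rfl⟩ := hc
    refine Subgroup.subset_closure ⟨φ k '' O, k * g * k⁻¹, k * h * k⁻¹,
      (φ k).isOpenMap O hO, hne.image _, ?_, ?_, ?_⟩
    · rintro _ ⟨x, hx, rfl⟩
      rw [map_mul, map_mul, Homeomorph.mul_apply, Homeomorph.mul_apply, inv_apply_apply, hg x hx]
    · rintro _ ⟨x, hx, rfl⟩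
      rw [map_mul, map_mul, Homeomorph.mul_apply, Homeomorph.mul_apply, inv_apply_apply, hh x hx]
    · simp only [commutatorElement_def]; group
  | one => simp
  | mul a b _ _ ha hb =>
    have := mul_mem ha hb
    convert this using 1
    group
  | inv a _ ha =>
    have := inv_mem ha
    convert this using 1
    group

/-- A nontrivial subgroup normalized by the derived subgroup of a compressing group contains all
commutators of elements with a common nonempty open set of fixed points. -/
theorem localCommutator_le [T2Space X] (hφ : Function.Injective φ)
    (hX : ∀ U : Set X, IsOpen U → U.Nonempty → U.Infinite) (hc : IsCompressing φ)
    {ι : Type*} {f : ι → G} (hgen : Subgroup.closure (range f) = ⊤)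
    (O : ι → Set X) (hO : ∀ i, IsOpen (O i)) (hne : ∀ i, (O i).Nonempty)
    (hf : ∀ i, f i ∈ fixer φ (O i)) (N : Subgroup G)
    (hN : ∀ k ∈ commutator G, ∀ a ∈ N, k * a * k⁻¹ ∈ N) {a : G} (haN : a ∈ N) (ha : a ≠ 1) :
    localCommutator φ ≤ N := by
  obtain ⟨x, hx⟩ : ∃ x, φ a x ≠ x := by
    by_contra hcon
    push Not at hcon
    exact ha (hφ (by ext x; simp [hcon x]))
  obtain ⟨V, W, hVo, hWo, hxV, hxW, hVW⟩ := t2_separation hx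
  set U : Set X := W ∩ φ a ⁻¹' V with hU
  have hUo : IsOpen U := hWo.inter (hVo.preimage (φ a).continuous)
  have haU : ∀ y ∈ U, φ a y ∉ U := fun y hy h => disjoint_left.1 hVW hy.2 h.1
  have hUne : U.Nonempty := ⟨x, hxW, hxV⟩
  obtain ⟨P, hPo, hPne, hPU, hPd⟩ := exists_disjoint_open_subsets (E := Fin 3)
    (fun _ => U) (fun _ => hUo) (fun _ => hX _ hUo hUne)
  rw [localCommutator, Subgroup.closure_le]
  rintro _ ⟨Q, g, h, hQo, hQne, hg, hh, rfl⟩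
  choose k hk using fun r => hc Q (P r) hQo hQne (hPo r) (hPne r)
  -- `N` is normalized only by the derived subgroup, so the conjugator `k 0` is corrected into it by
  -- an element that acts trivially on `P 0`.
  obtain ⟨w, hw, hwk⟩ := exists_mul_mem_commutator hgen (fixer φ (P 0)) (fun i => by
    obtain ⟨r, hr⟩ := hc (O i) (P 1) (hO i) (hne i) (hPo 1) (hPne 1)
    exact ⟨r, fixer_anti (disjoint_left.1 (hPd 0 1 (by decide))) (conj_mem_fixer (hf i) hr)⟩) (k 0)
  set k0 := w * k 0
  have hk0 : ∀ y, y ∉ Q → φ k0 y ∈ P 0 := by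
    intro y hy
    rw [map_mul, Homeomorph.mul_apply, hw _ (hk 0 y hy)]
    exact hk 0 y hy
  set g0 := k0 * g * k0⁻¹
  set h0 := k0 * h * k0⁻¹
  -- The copies of `g⁻¹` and `h⁻¹` in `P 1` and `P 2` serve only to bring `g0 * g1` and `h0 * h2`
  -- into the derived subgroup.
  set g1 := k 1 * g⁻¹ * (k 1)⁻¹
  set h2 := k 2 * h⁻¹ * (k 2)⁻¹
  have fg0 : g0 ∈ fixer φ (P 0)ᶜ := conj_mem_fixer hg hk0
  have fh0 : h0 ∈ fixer φ (P 0)ᶜ := conj_mem_fixer hh hk0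
  have fg1 : g1 ∈ fixer φ (P 1)ᶜ := conj_mem_fixer (inv_mem hg) (hk 1)
  have fh2 : h2 ∈ fixer φ (P 2)ᶜ := conj_mem_fixer (inv_mem hh) (hk 2)
  have c1 : Commute g1 h0 := commute_of_fixer hφ fg1 fh0 (hPd _ _ (by decide))
  have c2 : Commute g1 h2 := commute_of_fixer hφ fg1 fh2 (hPd _ _ (by decide))
  have c3 : Commute g0 h2 := commute_of_fixer hφ fg0 fh2 (hPd _ _ (by decide))
  have c4 : Commute h0 h2 := commute_of_fixer hφ fh0 fh2 (hPd _ _ (by decide))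
  have hsub : ∀ r, fixer φ (P r)ᶜ ≤ fixer φ Uᶜ := fun r =>
    fixer_anti (compl_subset_compl.2 (hPU r))
  have fg' : g0 * g1 ∈ fixer φ Uᶜ := mul_mem (hsub 0 fg0) (hsub 1 fg1)
  have fh' : h0 * h2 ∈ fixer φ Uᶜ := mul_mem (hsub 0 fh0) (hsub 2 fh2)
  have hcomm : ∀ b r : G, (k0 * b * k0⁻¹) * (r * b⁻¹ * r⁻¹) ∈ commutator G := by
    intro b r
    have h1 := conj_mul_inv_mem_commutator (k0 * b * k0⁻¹) (r * k0⁻¹)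
    convert h1 using 1
    group
  have hg'G : g0 * g1 ∈ commutator G := hcomm g (k 1)
  have hh'G : h0 * h2 ∈ commutator G := hcomm h (k 2)
  have hn : (g0 * g1) * (a * (g0 * g1)⁻¹ * a⁻¹) ∈ N := by
    have := mul_mem (hN _ hg'G a haN) (inv_mem haN)
    convert this using 1
    group
  have fb : a * (g0 * g1)⁻¹ * a⁻¹ ∈ fixer φ (Uᶜ)ᶜ := by
    refine conj_mem_fixer (S := Uᶜ) (inv_mem fg') fun y hy => haU y ?_
    simpa using hy
  set b := a * (g0 * g1)⁻¹ * a⁻¹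
  have cb : Commute b (h0 * h2) := commute_of_fixer hφ fb fh' disjoint_compl_left
  -- Because `a` moves `U` off itself, `b` commutes with `h0 * h2`, and the commutator of `⁅g0 * g1,
  -- a⁆` with `h0 * h2` collapses to `⁅g0, h0⁆`.
  have hmem : ⁅g0, h0⁆ ∈ N := by
    have e1 : (g0 * g1 * b) * ((h0 * h2) * (g0 * g1 * b)⁻¹ * (h0 * h2)⁻¹) ∈ N :=
      mul_mem hn (hN _ hh'G _ (inv_mem hn))
    have c5 : Commute g1 (h0 * h2) := c1.mul_right c2
    have e2 : (g0 * g1 * b) * ((h0 * h2) * (g0 * g1 * b)⁻¹ * (h0 * h2)⁻¹) = ⁅g0, h0⁆ := by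
      have c6 : Commute (g1 * b) (h0 * h2) := c5.mul_left cb
      calc (g0 * g1 * b) * ((h0 * h2) * (g0 * g1 * b)⁻¹ * (h0 * h2)⁻¹)
          = g0 * ((g1 * b) * (h0 * h2)) * (g1 * b)⁻¹ * g0⁻¹ * (h0 * h2)⁻¹ := by group
        _ = g0 * ((h0 * h2) * (g1 * b)) * (g1 * b)⁻¹ * g0⁻¹ * (h0 * h2)⁻¹ := by rw [c6.eq]
        _ = g0 * h0 * (h2 * g0⁻¹) * (h0 * h2)⁻¹ := by group
        _ = g0 * h0 * (g0⁻¹ * h2) * (h2⁻¹ * h0⁻¹) := by rw [c3.symm.inv_right.eq]; group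
        _ = ⁅g0, h0⁆ := by rw [commutatorElement_def]; group
    rwa [e2] at e1
  have hfin := hN k0⁻¹ (inv_mem hwk) _ hmem
  have : k0⁻¹ * ⁅g0, h0⁆ * k0⁻¹⁻¹ = ⁅g, h⁆ := by
    simp only [commutatorElement_def, g0, h0]; group
  rwa [this] at hfin

/-- Simplicity of the derived subgroup of a compressing group whose generators commute modulo
local commutators. -/
theorem isSimpleGroup_commutator_of_isCompressing [T2Space X] (hφ : Function.Injective φ)
    (hX : ∀ U : Set X, IsOpen U → U.Nonempty → U.Infinite) (hc : IsCompressing φ)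
    {ι : Type*} {f : ι → G} (hgen : Subgroup.closure (range f) = ⊤)
    (O : ι → Set X) (hO : ∀ i, IsOpen (O i)) (hne : ∀ i, (O i).Nonempty)
    (hf : ∀ i, f i ∈ fixer φ (O i)) (hcomm : ∀ i j, ⁅f i, f j⁆ ∈ localCommutator φ)
    (hnt : ∃ a b : G, ¬ Commute a b) : IsSimpleGroup (commutator G) := by
  have hle : commutator G ≤ localCommutator φ :=
    commutator_le_of_generators_commute hgen _ hcomm
  have hmem : ∀ a b : G, ⁅a, b⁆ ∈ commutator G := fun a b =>
    Subgroup.commutator_mem_commutator (Subgroup.mem_top _) (Subgroup.mem_top _)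
  have : Nontrivial (commutator G) := by
    obtain ⟨a, b, hab⟩ := hnt
    refine ⟨⟨⟨⁅a, b⁆, hmem a b⟩, 1, fun h => hab ?_⟩⟩
    exact commutatorElement_eq_one_iff_commute.1 (congrArg Subtype.val h)
  refine ⟨fun N hN => ?_⟩
  rw [or_iff_not_imp_left]
  intro hbot
  obtain ⟨a, ha1⟩ := N.ne_bot_iff_exists_ne_one.1 hbot
  have key : localCommutator φ ≤ N.map (commutator G).subtype := by
    refine localCommutator_le hφ hX hc hgen O hO hne hf (N.map (commutator G).subtype) ?_
      (a := ((a : commutator G) : G)) ⟨a, a.2, rfl⟩ ?_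
    · rintro k hk _ ⟨b, hb, rfl⟩
      exact ⟨⟨k, hk⟩ * b * ⟨k, hk⟩⁻¹, hN.conj_mem _ hb _, rfl⟩
    · intro h
      exact ha1 (Subtype.ext (Subtype.ext h))
  rw [eq_top_iff]
  intro x _
  obtain ⟨y, hy, hyx⟩ := key (hle x.2)
  have : y = x := Subtype.ext hyx
  exact this ▸ hy

end Homeo

/-! ### The piecewise linear bump -/

section Bump

/-- A piecewise linear homeomorphism of the line with support `(0, 4)`. -/
noncomputable def bump (t : ℝ) : ℝ := max t (min (3 * t) ((t + 8) / 3))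

/-- The inverse of `bump`. -/
noncomputable def bumpInv (t : ℝ) : ℝ := min t (max (t / 3) (3 * t - 8))

theorem bump_of_le_one {t : ℝ} (h0 : 0 ≤ t) (h1 : t ≤ 1) : bump t = 3 * t := by
  rw [bump, min_eq_left (by linarith), max_eq_right (by linarith)]

theorem bump_of_one_le {t : ℝ} (h0 : 1 ≤ t) (h1 : t ≤ 4) : bump t = (t + 8) / 3 := by
  rw [bump, min_eq_right (by linarith), max_eq_right (by linarith)]

theorem bump_of_four_le {t : ℝ} (h : 4 ≤ t) : bump t = t := by
  rw [bump, min_eq_right (by linarith), max_eq_left (by linarith)]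

theorem bump_of_nonpos {t : ℝ} (h : t ≤ 0) : bump t = t := by
  rw [bump, min_eq_left (by linarith), max_eq_left (by linarith)]

theorem lt_bump {t : ℝ} (h0 : 0 < t) (h1 : t < 4) : t < bump t := by
  rw [bump, lt_max_iff, lt_min_iff]
  right
  constructor <;> linarith

theorem bump_strictMono : StrictMono bump := by
  intro s t h
  rw [bump, bump]
  refine max_lt_max h (min_lt_min ?_ ?_) <;> linarith

theorem bump_bumpInv (t : ℝ) : bump (bumpInv t) = t := by
  rcases le_total t 0 with h0 | h0
  · have : bumpInv t = t := by
      rw [bumpInv, max_eq_left (by linarith), min_eq_left (by linarith)]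
    rw [this, bump_of_nonpos h0]
  rcases le_total t 3 with h3 | h3
  · have : bumpInv t = t / 3 := by
      rw [bumpInv, max_eq_left (by linarith), min_eq_right (by linarith)]
    rw [this, bump_of_le_one (by linarith) (by linarith)]
    ring
  rcases le_total t 4 with h4 | h4
  · have : bumpInv t = 3 * t - 8 := by
      rw [bumpInv, max_eq_right (by linarith), min_eq_right (by linarith)]
    rw [this, bump_of_one_le (by linarith) (by linarith)]
    ring
  · have : bumpInv t = t := by
      rw [bumpInv, max_eq_right (by linarith), min_eq_left (by linarith)]
    rw [this, bump_of_four_le h4]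

end Bump

/-! ### Periodic lifts of the generators -/

section Lift

variable (n : ℕ)

/-- The left end of the fundamental domain around `x` of the intervals indexed by `k` modulo
`n`, halved. -/
noncomputable def cell (k : ℤ) (x : ℝ) : ℤ := k + n * ⌊(x - 2 * k) / (2 * n)⌋

/-- The function equal to a translate of `bump` on every fundamental domain. -/
noncomputable def liftFun (b : ℝ → ℝ) (k : ℤ) (x : ℝ) : ℝ :=
  2 * cell n k x + b (x - 2 * cell n k x)

variable [hn : Fact (3 ≤ n)]

theorem three_le_cast : (3 : ℝ) ≤ n := by exact_mod_cast hn.out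

theorem cell_le (k : ℤ) (x : ℝ) : 2 * (cell n k x : ℝ) ≤ x := by
  have h3 := three_le_cast n
  have h := Int.floor_le ((x - 2 * k) / (2 * n))
  rw [le_div_iff₀ (by linarith)] at h
  rw [cell]; push_cast; linarith

theorem lt_cell_add (k : ℤ) (x : ℝ) : x < 2 * (cell n k x : ℝ) + 2 * n := by
  have h3 := three_le_cast n
  have h := Int.lt_floor_add_one ((x - 2 * k) / (2 * n))
  rw [div_lt_iff₀ (by linarith)] at h
  rw [cell]; push_cast; linarith

theorem cell_eq {k m j : ℤ} {x : ℝ} (hm : m = k + n * j) (h0 : 2 * (m : ℝ) ≤ x)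
    (h1 : x < 2 * m + 2 * n) : cell n k x = m := by
  have h3 := three_le_cast n
  subst hm
  have : ⌊(x - 2 * k) / (2 * n)⌋ = j := by
    rw [Int.floor_eq_iff, le_div_iff₀ (by linarith), div_lt_iff₀ (by linarith)]
    push_cast at h0 h1
    constructor <;> linarith
  rw [cell, this]

/-- Because `b` fixes `0` and `2 * n`, the formulas on neighbouring fundamental domains agree at the
common endpoint, so the right end may be included. -/
theorem liftFun_eq {b : ℝ → ℝ} (hb0 : b 0 = 0) (hb : b (2 * n) = 2 * n) {k m j : ℤ} {x : ℝ}
    (hm : m = k + n * j) (h0 : 2 * (m : ℝ) ≤ x) (h1 : x ≤ 2 * m + 2 * n) :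
    liftFun n b k x = 2 * m + b (x - 2 * m) := by
  rcases h1.lt_or_eq with h1 | h1
  · rw [liftFun, cell_eq n hm h0 h1]
  · have h3 := three_le_cast n
    have : cell n k x = m + n := by
      refine cell_eq n (j := j + 1) (by rw [hm]; ring) ?_ ?_ <;> push_cast <;> linarith
    rw [liftFun, this, h1]
    push_cast
    rw [show (2 * (m : ℝ) + 2 * n - 2 * (m + n)) = 0 by ring,
      show (2 * (m : ℝ) + 2 * n - 2 * m) = 2 * n by ring, hb0, hb]
    ring

theorem liftFun_strictMono {b : ℝ → ℝ} (hb : StrictMono b) (hb0 : b 0 = 0)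
    (hbn : b (2 * n) = 2 * n) (k : ℤ) : StrictMono (liftFun n b k) := by
  intro x y hxy
  have h3 := three_le_cast n
  have hx0 := cell_le n k x
  have hx1 := lt_cell_add n k x
  have hy0 := cell_le n k y
  have hy1 := lt_cell_add n k y
  rw [liftFun, liftFun]
  rcases lt_trichotomy ⌊(x - 2 * k) / (2 * n)⌋ ⌊(y - 2 * k) / (2 * n)⌋ with h | h | h
  · have h1 : cell n k x + n ≤ cell n k y := by
      rw [cell, cell]
      have : (n : ℤ) * (⌊(x - 2 * k) / (2 * n)⌋ + 1) ≤ n * ⌊(y - 2 * k) / (2 * n)⌋ := by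
        gcongr
        exact h
      linarith
    have h2 : (cell n k x : ℝ) + n ≤ cell n k y := by exact_mod_cast h1
    have h4 := hb (show x - 2 * cell n k x < 2 * n by linarith)
    have h5 := hb.monotone (show 0 ≤ y - 2 * cell n k y by linarith)
    linarith
  · have h1 : cell n k x = cell n k y := by rw [cell, cell, h]
    rw [h1]
    have := hb (show x - 2 * cell n k y < y - 2 * cell n k y by linarith)
    linarith
  · exfalso
    have : (x - 2 * k) / (2 * n) ≤ (y - 2 * k) / (2 * n) := by gcongr
    exact absurd (Int.floor_mono this) (not_le.2 h)

theorem bump_two_mul : bump (2 * n) = 2 * n :=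
  bump_of_four_le (by linarith [three_le_cast n])

theorem bump_zero : bump 0 = 0 := bump_of_nonpos le_rfl

theorem liftFun_liftFun_inv (k : ℤ) (x : ℝ) :
    liftFun n bump k (liftFun n bumpInv k x) = x := by
  have h3 := three_le_cast n
  have hx0 := cell_le n k x
  have hx1 := lt_cell_add n k x
  obtain ⟨c, hc⟩ : ∃ c, c = cell n k x := ⟨_, rfl⟩
  rw [← hc] at hx0 hx1
  have hb := bump_bumpInv (x - 2 * c)
  have h0 : 0 ≤ bumpInv (x - 2 * c) := by
    rw [← bump_strictMono.le_iff_le, hb, bump_zero]; linarith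
  have h1 : bumpInv (x - 2 * c) ≤ 2 * n := by
    rw [← bump_strictMono.le_iff_le, hb, bump_two_mul]; linarith
  rw [liftFun_eq n bump_zero (bump_two_mul n) (m := c)
    (j := ⌊(x - 2 * k) / (2 * n)⌋) (by rw [hc, cell])]
  · rw [liftFun, ← hc, add_sub_cancel_left, hb]; ring
  · rw [liftFun, ← hc]; linarith
  · rw [liftFun, ← hc]; linarith

/-- The lift to the line of the `k`-th generator: on `[2 k, 2 k + 2 n]` it is a translate of
`bump`, and it commutes with the translation by `2 n`. -/
noncomputable def lift (k : ℤ) : ℝ ≃ₜ ℝ :=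
  (StrictMono.orderIsoOfRightInverse _
    (liftFun_strictMono n bump_strictMono bump_zero (bump_two_mul n) k)
    _ (liftFun_liftFun_inv n k)).toHomeomorph

theorem lift_def (k : ℤ) (x : ℝ) : lift n k x = liftFun n bump k x := rfl

theorem lift_strictMono (k : ℤ) : StrictMono (lift n k) :=
  liftFun_strictMono n bump_strictMono bump_zero (bump_two_mul n) k

theorem lift_apply {m : ℤ} {x : ℝ} (h0 : 2 * (m : ℝ) ≤ x) (h1 : x ≤ 2 * m + 2 * n) :
    lift n m x = 2 * m + bump (x - 2 * m) :=
  liftFun_eq n bump_zero (bump_two_mul n) (j := 0) (by simp) h0 h1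

theorem lift_add_mul (k j : ℤ) : lift n (k + n * j) = lift n k := by
  ext x
  have hx0 := cell_le n k x
  have hx1 := lt_cell_add n k x
  rw [lift_def, lift_def,
    liftFun_eq n bump_zero (bump_two_mul n) (m := cell n k x) (k := k + n * j)
      (j := ⌊(x - 2 * k) / (2 * n)⌋ - j) (by rw [cell]; ring) hx0 hx1.le, liftFun]

theorem lift_add_period (k : ℤ) (x : ℝ) : lift n k (x + 2 * n) = lift n k x + 2 * n := by
  have hx0 := cell_le n k x
  have hx1 := lt_cell_add n k x
  rw [lift_def, lift_def,
    liftFun_eq n bump_zero (bump_two_mul n) (m := cell n k x + n) (k := k)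
      (j := ⌊(x - 2 * k) / (2 * n)⌋ + 1) (by rw [cell]; ring) (by push_cast; linarith)
      (by push_cast; linarith), liftFun]
  push_cast
  rw [show x + 2 * (n : ℝ) - 2 * (cell n k x + n) = x - 2 * cell n k x by ring]
  ring

theorem lift_fixed {m : ℤ} {x : ℝ} (h0 : 2 * (m : ℝ) + 4 ≤ x) (h1 : x ≤ 2 * m + 2 * n) :
    lift n m x = x := by
  rw [lift_apply n (by linarith) h1, bump_of_four_le (by linarith)]; ring

theorem lift_fixed_left (m : ℤ) : lift n m (2 * m) = 2 * m := by
  have h3 := three_le_cast n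
  rw [lift_apply n le_rfl (by linarith), sub_self, bump_zero, add_zero]

theorem lt_lift {m : ℤ} {x : ℝ} (h0 : 2 * (m : ℝ) < x) (h1 : x < 2 * m + 4) :
    x < lift n m x := by
  have h3 := three_le_cast n
  rw [lift_apply n h0.le (by linarith)]
  have := lt_bump (t := x - 2 * m) (by linarith) (by linarith)
  linarith

theorem lift_expand {m : ℤ} {x : ℝ} (h0 : 2 * (m : ℝ) ≤ x) (h1 : x ≤ 2 * m + 1) :
    lift n m x = 2 * m + 3 * (x - 2 * m) := by
  have h3 := three_le_cast n
  rw [lift_apply n h0 (by linarith), bump_of_le_one (by linarith) (by linarith)]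

theorem lift_contract {m : ℤ} {x : ℝ} (h0 : 2 * (m : ℝ) + 1 ≤ x) (h1 : x ≤ 2 * m + 4) :
    lift n m x = 2 * m + (x - 2 * m + 8) / 3 := by
  have h3 := three_le_cast n
  rw [lift_apply n (by linarith) (by linarith), bump_of_one_le (by linarith) (by linarith)]

end Lift

/-! ### Dynamics of the lifted group: compression of short intervals -/

section LiftGroup

variable (n : ℕ)

/-- The group of increasing homeomorphisms of the line commuting with the translation by
`2 n`. -/
def periodic : Subgroup (ℝ ≃ₜ ℝ) where
  carrier := {g | StrictMono g ∧ ∀ x, g (x + 2 * n) = g x + 2 * n}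
  one_mem' := ⟨strictMono_id, fun _ => rfl⟩
  mul_mem' := fun {a b} ha hb => ⟨ha.1.comp hb.1, fun x => by
    rw [Homeomorph.mul_apply, hb.2, ha.2, Homeomorph.mul_apply]⟩
  inv_mem' := fun {a} ha => by
    refine ⟨fun x y hxy => ?_, fun x => ?_⟩
    · rw [← ha.1.lt_iff_lt]
      simpa using hxy
    · rw [Homeomorph.inv_apply, Homeomorph.symm_apply_eq, ha.2, Homeomorph.inv_apply,
        Homeomorph.apply_symm_apply]

variable {n} in
theorem periodic_add_mul {g : ℝ ≃ₜ ℝ} (hg : g ∈ periodic n) (x : ℝ) (j : ℤ) :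
    g (x + 2 * n * j) = g x + 2 * n * j := by
  induction j using Int.induction_on with
  | zero => simp
  | succ i ih =>
    have := hg.2 (x + 2 * n * (i : ℤ))
    rw [ih] at this
    push_cast at this ⊢
    rw [mul_add, mul_one, ← add_assoc, this]; ring
  | pred i ih =>
    have := hg.2 (x + 2 * n * ((-i - 1 : ℤ) : ℝ))
    have e : x + 2 * n * ((-i - 1 : ℤ) : ℝ) + 2 * n = x + 2 * n * ((-i : ℤ) : ℝ) := by
      push_cast; ring
    rw [e, ih] at this
    push_cast at this ⊢
    linarith

variable [hn : Fact (3 ≤ n)]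

/-- The group generated by the lifts of the generators. -/
noncomputable def liftGroup : Subgroup (ℝ ≃ₜ ℝ) := Subgroup.closure (range (lift n))

variable {n}

theorem lift_mem (k : ℤ) : lift n k ∈ liftGroup n := Subgroup.subset_closure ⟨k, rfl⟩

theorem liftGroup_le_periodic : liftGroup n ≤ periodic n := by
  rw [liftGroup, Subgroup.closure_le]
  rintro _ ⟨k, rfl⟩
  exact ⟨lift_strictMono n k, lift_add_period n k⟩

theorem strictMono_of_mem {g : ℝ ≃ₜ ℝ} (hg : g ∈ liftGroup n) : StrictMono g :=
  (liftGroup_le_periodic hg).1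

/-- An orbit that never passed `y` would increase to a fixed point of `g` in `[x, y]`. -/
theorem exists_pow_gt (g : ℝ ≃ₜ ℝ) {x y : ℝ} (h : ∀ z, x ≤ z → z ≤ y → z < g z) :
    ∃ N : ℕ, y < (g ^ N) x := by
  by_contra! hcon
  have hstep : ∀ N : ℕ, (g ^ (N + 1)) x = g ((g ^ N) x) := fun N => by
    rw [pow_succ', Homeomorph.mul_apply]
  have hge : ∀ N : ℕ, x ≤ (g ^ N) x := by
    intro N
    induction N with
    | zero => simp
    | succ N ih =>
      rw [hstep]
      exact ih.trans (h _ ih (hcon N)).le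
  have hmono : Monotone fun N : ℕ => (g ^ N) x :=
    monotone_nat_of_le_succ fun N => by
      rw [hstep]
      exact (h _ (hge N) (hcon N)).le
  have hlim := tendsto_atTop_ciSup hmono ⟨y, by rintro _ ⟨N, rfl⟩; exact hcon N⟩
  set c := ⨆ N : ℕ, (g ^ N) x
  have hc0 : x ≤ c := ge_of_tendsto' hlim hge
  have hc1 : c ≤ y := le_of_tendsto' hlim hcon
  have h1 : Tendsto (fun N : ℕ => (g ^ (N + 1)) x) atTop (𝓝 c) :=
    hlim.comp (tendsto_add_atTop_nat 1)
  have h2 : Tendsto (fun N : ℕ => (g ^ (N + 1)) x) atTop (𝓝 (g c)) := by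
    simp_rw [hstep]
    exact (g.continuous.tendsto c).comp hlim
  exact (h c hc0 hc1).ne (tendsto_nhds_unique h1 h2)

/-- Points of `(2 m, 2 m + 2 r + 4)` can be pushed towards `2 m`. -/
theorem exists_push_left (r : ℕ) (hr : r + 2 ≤ n) (m : ℤ) (v ε : ℝ) (hε : 0 < ε)
    (hv : v < 2 * (m + r) + 4) :
    ∃ g ∈ liftGroup n, g (2 * m) = 2 * m ∧ g v < 2 * m + ε := by
  induction r generalizing v with
  | zero =>
    obtain ⟨N, hN⟩ := exists_pow_gt (lift n m) (x := 2 * m + ε) (y := v)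
      (fun z h0 h1 => lt_lift n (by linarith) (by push_cast at hv; linarith))
    have hmem : ((lift n m) ^ N)⁻¹ ∈ liftGroup n := inv_mem (pow_mem (lift_mem m) N)
    refine ⟨((lift n m) ^ N)⁻¹, hmem, ?_, ?_⟩
    · rw [Homeomorph.inv_apply, Homeomorph.symm_apply_eq]
      clear hN hmem
      induction N with
      | zero => simp
      | succ N ih => rw [pow_succ, Homeomorph.mul_apply, lift_fixed_left, ← ih]
    · have := strictMono_of_mem hmem hN
      simpa using this
  | succ r ih =>
    rcases le_or_gt v (2 * (m + (r + 1))) with h | h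
    · exact ih (by omega) v (by linarith)
    -- The last bump, run backwards, brings `v` below `2 k + 1`, within reach of the first `r + 1`
    -- bumps.
    · set k : ℤ := m + r + 1
      have hk : (k : ℝ) = m + r + 1 := by simp [k]
      obtain ⟨N, hN⟩ := exists_pow_gt (lift n k) (x := 2 * k + 1) (y := v)
        (fun z h0 h1 => lt_lift n (by linarith) (by push_cast at hv; linarith))
      have hmem : ((lift n k) ^ N)⁻¹ ∈ liftGroup n := inv_mem (pow_mem (lift_mem k) N)
      have h1 := strictMono_of_mem hmem hN
      rw [Homeomorph.inv_apply, Homeomorph.inv_apply, Homeomorph.symm_apply_apply] at h1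
      obtain ⟨g, hg, hgm, hgv⟩ := ih (by omega) (((lift n k) ^ N).symm v) (by linarith)
      refine ⟨g * ((lift n k) ^ N)⁻¹, mul_mem hg hmem, ?_, ?_⟩
      · have hfix : lift n k (2 * m) = 2 * m := by
          -- One period lower, the support of `lift n k` ends at `2 k - 2 n + 4`, which is at most
          -- `2 m` since `r + 3 ≤ n`.
          have e : lift n k = lift n (k + n * (-1)) := (lift_add_mul n k (-1)).symm
          have hr' : ((r : ℝ) + 1) + 2 ≤ n := by exact_mod_cast hr
          rw [e, lift_fixed n] <;> push_cast <;> linarith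
        have hfixN : ∀ N : ℕ, ((lift n k) ^ N) (2 * m) = 2 * m := by
          intro N
          induction N with
          | zero => simp
          | succ N ih => rw [pow_succ, Homeomorph.mul_apply, hfix, ih]
        rw [Homeomorph.mul_apply, Homeomorph.inv_apply,
          (Homeomorph.symm_apply_eq _).2 (hfixN N).symm, hgm]
      · rw [Homeomorph.mul_apply, Homeomorph.inv_apply]
        exact hgv

theorem exists_compress_left (m : ℤ) {u v ε : ℝ} (hε : 0 < ε) (hu : 2 * m < u)
    (hv : v < 2 * m + 2 * n) :
    ∃ g ∈ liftGroup n, 2 * m < g u ∧ g v < 2 * m + ε := by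
  have h3 := hn.out
  have h2 : ((n - 2 : ℕ) : ℝ) = n - 2 := by rw [Nat.cast_sub (by omega)]; norm_num
  -- With `r = n - 2` the reach `2 (m + r) + 4` is exactly one period beyond `2 m`.
  obtain ⟨g, hg, hgm, hgv⟩ := exists_push_left (n := n) (n - 2) (by omega) m v ε hε (by
    rw [h2]; linarith)
  exact ⟨g, hg, hgm ▸ strictMono_of_mem hg hu, hgv⟩

theorem exists_compress_pred (m : ℤ) {u v : ℝ} (hu : 2 * m < u)
    (hv : v < 2 * m + 2 * n) :
    ∃ g ∈ liftGroup n, 2 * ((m - 1 : ℤ) : ℝ) < g u ∧ g v < 2 * ((m - 1 : ℤ) : ℝ) + 2 * n := by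
  have h3 := three_le_cast n
  obtain ⟨g, hg, h1, h2⟩ := exists_compress_left m one_pos hu hv
  exact ⟨g, hg, by push_cast; linarith, by push_cast; linarith⟩

/-- After compression near `2 m`, powers of `lift n m` raise the left end above `2 m + 2`, while
their fixed point `2 m + 4` keeps the right end bounded. -/
theorem exists_compress_succ (m : ℤ) {u v : ℝ} (hu : 2 * m < u)
    (hv : v < 2 * m + 2 * n) :
    ∃ g ∈ liftGroup n, 2 * ((m + 1 : ℤ) : ℝ) < g u ∧ g v < 2 * ((m + 1 : ℤ) : ℝ) + 2 * n := by
  have h3 := three_le_cast n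
  obtain ⟨g, hg, h1, h2⟩ := exists_compress_left m one_pos hu hv
  obtain ⟨N, hN⟩ := exists_pow_gt (lift n m) (x := g u) (y := 2 * m + 2)
      (fun z h0 h1 => lt_lift n (by linarith) (by linarith))
  have hmem : (lift n m) ^ N ∈ liftGroup n := pow_mem (lift_mem m) N
  have h4 : ((lift n m) ^ N) (2 * m + 4) = 2 * m + 4 := by
    clear hN hmem
    induction N with
    | zero => simp
    | succ N ih =>
      rw [pow_succ, Homeomorph.mul_apply, lift_fixed n (by linarith) (by linarith), ih]
  have h5 := strictMono_of_mem hmem (show g v < 2 * m + 4 by linarith)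
  refine ⟨(lift n m) ^ N * g, mul_mem hmem hg, ?_, ?_⟩
  · rw [Homeomorph.mul_apply]; push_cast; linarith
  · rw [Homeomorph.mul_apply]; push_cast; linarith

theorem exists_compress_any (m k : ℤ) {u v : ℝ} (hu : 2 * m < u)
    (hv : v < 2 * m + 2 * n) :
    ∃ g ∈ liftGroup n, 2 * (k : ℝ) < g u ∧ g v < 2 * (k : ℝ) + 2 * n := by
  induction k using Int.inductionOn' (b := m) with
  | zero => exact ⟨1, one_mem _, hu, hv⟩
  | succ k _ ih =>
    obtain ⟨g, hg, h1, h2⟩ := ih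
    obtain ⟨g', hg', h1', h2'⟩ :=
      exists_compress_succ k h1 h2
    exact ⟨g' * g, mul_mem hg' hg, h1', h2'⟩
  | pred k _ ih =>
    obtain ⟨g, hg, h1, h2⟩ := ih
    obtain ⟨g', hg', h1', h2'⟩ :=
      exists_compress_pred k h1 h2
    exact ⟨g' * g, mul_mem hg' hg, h1', h2'⟩

/-- Without an even integer inside, the interval lies between two consecutive ones, and one of its
halves lies on a single side of the odd midpoint. A generator or an inverse stretches that half
threefold, so each round gains a factor `3 / 2`. -/
theorem exists_even_orbit_of_length (N : ℕ) {p q : ℝ} (hpq : p < q)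
    (hN : 2 < (q - p) * (3 / 2) ^ N) :
    ∃ g ∈ liftGroup n, ∃ m : ℤ, p < g (2 * m) ∧ g (2 * m) < q := by
  induction N generalizing p q with
  | zero =>
    refine ⟨1, one_mem _, ⌊p / 2⌋ + 1, ?_⟩
    have h1 := Int.floor_le (p / 2)
    have h2 := Int.lt_floor_add_one (p / 2)
    rw [pow_zero, mul_one] at hN
    rw [Homeomorph.one_apply]
    push_cast
    constructor <;> linarith
  | succ N ih =>
    obtain ⟨m, hm⟩ : ∃ m : ℤ, m = ⌊p / 2⌋ := ⟨_, rfl⟩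
    have h1 := Int.floor_le (p / 2)
    have h2 := Int.lt_floor_add_one (p / 2)
    rw [← hm] at h1 h2
    rw [pow_succ] at hN
    rcases lt_or_ge (2 * (m : ℝ) + 2) q with hq | hq
    · refine ⟨1, one_mem _, m + 1, ?_⟩
      rw [Homeomorph.one_apply]
      push_cast
      constructor <;> linarith
    rcases le_total ((p + q) / 2) (2 * m + 1) with hs | hs
    · have e1 := lift_expand n (m := m) (x := p) (by linarith) (by linarith)
      have e2 := lift_expand n (m := m) (x := (p + q) / 2) (by linarith) (by linarith)
      obtain ⟨g, hg, k, hk1, hk2⟩ := ih (p := lift n m p) (q := lift n m ((p + q) / 2))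
        (by linarith) (by rw [e1, e2]; linarith)
      have hmem := inv_mem (lift_mem (n := n) m)
      refine ⟨(lift n m)⁻¹ * g, mul_mem hmem hg, k, ?_, ?_⟩
      · simpa using strictMono_of_mem hmem hk1
      · have := strictMono_of_mem hmem hk2
        rw [Homeomorph.inv_apply, Homeomorph.inv_apply, Homeomorph.symm_apply_apply] at this
        rw [Homeomorph.mul_apply, Homeomorph.inv_apply]
        linarith
    -- `[2 m + 1, 2 m + 2]` is the closed right foot of generator `m - 1`, so its inverse does the
    -- stretching; the preimages are written out explicitly.
    · set l : ℤ := m - 1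
      have hl : (l : ℝ) = m - 1 := by simp [l]
      have e1 := lift_contract n (m := l) (x := 2 * l + 3 * ((p + q) / 2 - 2 * l) - 8)
        (by linarith) (by linarith)
      have e2 := lift_contract n (m := l) (x := 2 * l + 3 * (q - 2 * l) - 8)
        (by linarith) (by linarith)
      rw [show 2 * (l : ℝ) + (2 * l + 3 * ((p + q) / 2 - 2 * l) - 8 - 2 * l + 8) / 3
        = (p + q) / 2 by ring] at e1
      rw [show 2 * (l : ℝ) + (2 * l + 3 * (q - 2 * l) - 8 - 2 * l + 8) / 3 = q by ring] at e2
      obtain ⟨g, hg, k, hk1, hk2⟩ := ih (p := 2 * l + 3 * ((p + q) / 2 - 2 * l) - 8)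
        (q := 2 * l + 3 * (q - 2 * l) - 8) (by linarith) (by linarith)
      have hmem := lift_mem (n := n) l
      refine ⟨lift n l * g, mul_mem hmem hg, k, ?_, ?_⟩
      · have := strictMono_of_mem hmem hk1
        rw [Homeomorph.mul_apply]
        linarith
      · have := strictMono_of_mem hmem hk2
        rw [Homeomorph.mul_apply]
        linarith

theorem exists_even_orbit {p q : ℝ} (hpq : p < q) :
    ∃ g ∈ liftGroup n, ∃ m : ℤ, p < g (2 * m) ∧ g (2 * m) < q := by
  obtain ⟨N, hN⟩ := pow_unbounded_of_one_lt (2 / (q - p)) (show (1 : ℝ) < 3 / 2 by norm_num)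
  refine exists_even_orbit_of_length N hpq ?_
  rwa [div_lt_iff₀' (sub_pos.2 hpq)] at hN

/-- Any interval shorter than the period can be moved into any open interval. -/
theorem exists_compress {u v p q : ℝ} (hv : v < u + 2 * n) (hpq : p < q) :
    ∃ g ∈ liftGroup n, p < g u ∧ g v < q := by
  -- An image of an even integer in the gap between `v` and `u + 2 n`: pulling back by `a` places
  -- `u` and `v` strictly between `2 (m - n)` and `2 m`.
  obtain ⟨a, ha, m, ham, ham'⟩ := exists_even_orbit (n := n) hv
  obtain ⟨b, hb, k, hbk, hbk'⟩ := exists_even_orbit (n := n) hpq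
  have ha' := inv_mem ha
  have hb' := inv_mem hb
  have h1 := strictMono_of_mem ha' ham
  have h2 := strictMono_of_mem ha' ham'
  rw [(liftGroup_le_periodic ha').2] at h2
  have h3 := strictMono_of_mem hb' hbk'
  simp only [Homeomorph.inv_apply, Homeomorph.symm_apply_apply] at h1 h2 h3
  obtain ⟨c, hc, hc1, hc2⟩ := exists_compress_any (n := n) (m - n) k
    (u := a⁻¹ u) (v := a⁻¹ v)
    (by push_cast; rw [Homeomorph.inv_apply]; linarith)
    (by push_cast; rw [Homeomorph.inv_apply]; linarith)
  obtain ⟨d, hd, hd1, hd2⟩ := exists_compress_left (n := n) k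
    (ε := b.symm q - 2 * k) (by linarith) hc1 hc2
  refine ⟨b * (d * (c * a⁻¹)), mul_mem hb (mul_mem hd (mul_mem hc ha')), ?_, ?_⟩
  · have := strictMono_of_mem hb hd1
    simp only [Homeomorph.mul_apply]
    linarith
  · have := strictMono_of_mem hb (show d (c (a⁻¹ v)) < b.symm q by linarith)
    rw [Homeomorph.apply_symm_apply] at this
    exact this

end LiftGroup

/-! ### Ping-pong: the orbit of the origin -/

section Orbit

variable {n : ℕ} [hn : Fact (3 ≤ n)]

variable (n) in
/-- The points reached from `0` by reduced words in the lifted generators. -/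
inductive Reached : ℝ → Prop
  | zero : Reached 0
  | up (m : ℤ) (x : ℝ) (h : Reached x) (h0 : 2 * (m : ℝ) + 1 < x) (h1 : x < 2 * m + 4) :
      Reached (lift n m x)
  | down (m : ℤ) (x : ℝ) (h : Reached x) (h0 : 2 * (m : ℝ) < x) (h1 : x < 2 * m + 3) :
      Reached ((lift n m)⁻¹ x)

theorem lift_mem_right_foot {m : ℤ} {x : ℝ} (h0 : 2 * (m : ℝ) + 1 < x) (h1 : x < 2 * m + 4) :
    2 * (m : ℝ) + 3 < lift n m x ∧ lift n m x < 2 * m + 4 := by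
  rw [lift_contract n h0.le h1.le]
  constructor <;> linarith

theorem lift_inv_mem_left_foot {m : ℤ} {x : ℝ} (h0 : 2 * (m : ℝ) < x) (h1 : x < 2 * m + 3) :
    2 * (m : ℝ) < (lift n m)⁻¹ x ∧ (lift n m)⁻¹ x < 2 * m + 1 := by
  have e1 := lift_fixed_left n m
  have e2 := lift_expand n (m := m) (x := 2 * m + 1) (by linarith) le_rfl
  rw [← (lift_strictMono n m).lt_iff_lt, ← (lift_strictMono n m).lt_iff_lt (b := 2 * (m : ℝ) + 1),
    e1, e2, Homeomorph.inv_apply, Homeomorph.apply_symm_apply]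
  constructor <;> linarith

/-- Every step lands in an open foot, and each foot is a gap between consecutive integers. -/
theorem Reached.eq_zero_or {x : ℝ} (h : Reached n x) :
    x = 0 ∨ ∃ k : ℤ, (k : ℝ) < x ∧ x < k + 1 := by
  cases h with
  | zero => exact Or.inl rfl
  | up m x h h0 h1 =>
    refine Or.inr ⟨2 * m + 3, ?_⟩
    have := lift_mem_right_foot (n := n) h0 h1
    push_cast
    constructor <;> linarith
  | down m x h h0 h1 =>
    refine Or.inr ⟨2 * m, ?_⟩
    have := lift_inv_mem_left_foot (n := n) h0 h1
    push_cast
    constructor <;> linarith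

theorem Reached.ne_odd {x : ℝ} (h : Reached n x) (j : ℤ) : x ≠ 2 * j + 1 := by
  rintro rfl
  rcases h.eq_zero_or with h | ⟨k, h0, h1⟩
  · have : 2 * j + 1 = 0 := by exact_mod_cast h
    omega
  · have h0' : k < 2 * j + 1 := by exact_mod_cast h0
    have h1' : 2 * j + 1 < k + 1 := by exact_mod_cast h1
    omega

theorem lift_eq_cell (k : ℤ) (x : ℝ) : lift n k = lift n (cell n k x) := by
  rw [cell, lift_add_mul]

/-- Off the support nothing moves, and to the right of the left foot this is an `up` step. A reached
point inside the left foot can only have arrived by the `down` step of the same bump, as feet are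
disjoint, and that step is cancelled. -/
theorem reached_lift {x : ℝ} (h : Reached n x) (k : ℤ) : Reached n (lift n k x) := by
  have h0 := cell_le n k x
  have h1 := lt_cell_add n k x
  rw [lift_eq_cell k x]
  generalize cell n k x = m at *
  rcases le_or_gt (2 * (m : ℝ) + 4) x with h4 | h4
  · rwa [lift_fixed n h4 h1.le]
  rcases h0.eq_or_lt with h0 | h0
  · rw [← h0, lift_fixed_left, h0]; exact h
  rcases lt_trichotomy (2 * (m : ℝ) + 1) x with h3 | h3 | h3
  · exact Reached.up m x h h3 h4
  · exact absurd h3.symm (h.ne_odd m)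
  · cases h with
    | zero =>
      have e0 : m < 0 := by have : (m : ℝ) < 0 := by linarith
                            exact_mod_cast this
      have e1 : -1 < 2 * m := by have : (-1 : ℝ) < 2 * m := by linarith
                                 exact_mod_cast this
      omega
    | up l y hy hy0 hy1 =>
      have hy2 := lift_mem_right_foot (n := n) hy0 hy1
      have e0 : l + 1 < m := by have : (l : ℝ) + 1 < m := by linarith
                                exact_mod_cast this
      have e1 : m < l + 2 := by have : (m : ℝ) < l + 2 := by linarith
                                exact_mod_cast this
      omega
    | down l y hy hy0 hy1 =>
      have hy2 := lift_inv_mem_left_foot (n := n) hy0 hy1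
      have e0 : 2 * l < 2 * m + 1 := by have : (2 * l : ℝ) < 2 * m + 1 := by linarith
                                        exact_mod_cast this
      have e1 : 2 * m < 2 * l + 1 := by have : (2 * m : ℝ) < 2 * l + 1 := by linarith
                                        exact_mod_cast this
      obtain rfl : l = m := by omega
      rwa [Homeomorph.inv_apply, Homeomorph.apply_symm_apply]

theorem reached_lift_inv {x : ℝ} (h : Reached n x) (k : ℤ) : Reached n ((lift n k)⁻¹ x) := by
  have h0 := cell_le n k x
  have h1 := lt_cell_add n k x
  rw [lift_eq_cell k x]
  generalize cell n k x = m at *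
  rcases le_or_gt (2 * (m : ℝ) + 4) x with h4 | h4
  · rwa [Homeomorph.inv_apply, (Homeomorph.symm_apply_eq _).2 (lift_fixed n h4 h1.le).symm]
  rcases h0.eq_or_lt with h0 | h0
  · have e : lift n m x = x := by rw [← h0, lift_fixed_left]
    rwa [Homeomorph.inv_apply, (Homeomorph.symm_apply_eq _).2 e.symm]
  rcases lt_trichotomy x (2 * (m : ℝ) + 3) with h3 | h3 | h3
  · exact Reached.down m x h h0 h3
  · exact absurd (by rw [h3]; push_cast; ring) (h.ne_odd (m + 1))
  · cases h with
    | zero =>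
      have e0 : m < -1 := by have : (m : ℝ) < -1 := by linarith
                             exact_mod_cast this
      have e1 : -2 < m := by have : (-2 : ℝ) < m := by linarith
                             exact_mod_cast this
      omega
    | up l y hy hy0 hy1 =>
      have hy2 := lift_mem_right_foot (n := n) hy0 hy1
      have e0 : 2 * l < 2 * m + 1 := by have : (2 * l : ℝ) < 2 * m + 1 := by linarith
                                        exact_mod_cast this
      have e1 : 2 * m < 2 * l + 1 := by have : (2 * m : ℝ) < 2 * l + 1 := by linarith
                                        exact_mod_cast this
      obtain rfl : l = m := by omega
      rwa [Homeomorph.inv_apply, Homeomorph.symm_apply_apply]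
    | down l y hy hy0 hy1 =>
      have hy2 := lift_inv_mem_left_foot (n := n) hy0 hy1
      have e0 : l < m + 2 := by have : (l : ℝ) < m + 2 := by linarith
                                exact_mod_cast this
      have e1 : m + 1 < l := by have : (m : ℝ) + 1 < l := by linarith
                                exact_mod_cast this
      omega

theorem Reached.of_mem_liftGroup {g : ℝ ≃ₜ ℝ} (hg : g ∈ liftGroup n) {x : ℝ}
    (hx : Reached n x) : Reached n (g x) := by
  induction hg using Subgroup.closure_induction'' generalizing x with
  | mem g hg => obtain ⟨k, rfl⟩ := hg; exact reached_lift hx k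
  | inv_mem g hg => obtain ⟨k, rfl⟩ := hg; exact reached_lift_inv hx k
  | one => exact hx
  | mul a b _ _ ha hb => exact ha (hb hx)

/-- No element of the lifted group acts as a nontrivial translation by a multiple of the
period. -/
theorem eq_zero_of_translation {g : ℝ ≃ₜ ℝ} (hg : g ∈ liftGroup n) {j : ℤ}
    (hj : g 0 = 2 * n * j) : j = 0 := by
  have h3 := hn.out
  have h := Reached.of_mem_liftGroup hg Reached.zero
  rw [hj] at h
  rcases h.eq_zero_or with h | ⟨k, h0, h1⟩
  · have : 2 * (n : ℤ) * j = 0 := by exact_mod_cast h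
    rcases mul_eq_zero.1 this with h | h
    · omega
    · exact h
  · have h0' : k < 2 * n * j := by exact_mod_cast h0
    have h1' : 2 * n * j < k + 1 := by exact_mod_cast h1
    omega

end Orbit

/-! ### From periodic homeomorphisms to the circle -/

section Circle

variable (n : ℕ)

/-- The covering of the circle by the line with period `2 n`. -/
noncomputable def proj (x : ℝ) : UnitAddCircle := ((x / (2 * n) : ℝ) : UnitAddCircle)

variable [hn : Fact (3 ≤ n)]

theorem isOpenQuotientMap_proj : IsOpenQuotientMap (proj n) := by
  have h3 := three_le_cast n
  have h : IsOpenQuotientMap (fun x : ℝ => x * (2 * (n : ℝ))⁻¹) :=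
    (Homeomorph.mulRight₀ (2 * (n : ℝ))⁻¹ (by positivity)).isOpenQuotientMap
  exact (QuotientAddGroup.isOpenQuotientMap_mk (N := AddSubgroup.zmultiples (1 : ℝ))).comp h

variable {n}

theorem proj_eq_iff {x y : ℝ} : proj n x = proj n y ↔ ∃ j : ℤ, y = x + 2 * n * j := by
  have h3 := three_le_cast n
  rw [eq_comm, proj, proj, ← sub_eq_zero, ← AddCircle.coe_sub, AddCircle.coe_eq_zero_iff]
  refine exists_congr fun j => ?_
  rw [zsmul_eq_mul, mul_one, ← sub_div, eq_div_iff (by positivity)]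
  constructor <;> intro h <;> linarith

theorem proj_add (x : ℝ) (j : ℤ) : proj n (x + 2 * n * j) = proj n x :=
  (proj_eq_iff.2 ⟨j, rfl⟩).symm

variable (n) in
/-- The map of the circle covered by a map of the line. -/
noncomputable def descend (g : ℝ → ℝ) (c : UnitAddCircle) : UnitAddCircle :=
  proj n (g (Function.surjInv (isOpenQuotientMap_proj n).surjective c))

theorem descend_proj {g : ℝ ≃ₜ ℝ} (hg : g ∈ periodic n) (x : ℝ) :
    descend n g (proj n x) = proj n (g x) := by
  have h := Function.surjInv_eq (isOpenQuotientMap_proj n).surjective (proj n x)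
  obtain ⟨j, hj⟩ := proj_eq_iff.1 h
  rw [descend]
  generalize Function.surjInv _ (proj n x) = y at *
  rw [hj, periodic_add_mul hg, proj_add]

theorem continuous_descend {g : ℝ ≃ₜ ℝ} (hg : g ∈ periodic n) : Continuous (descend n g) := by
  rw [(isOpenQuotientMap_proj n).isQuotientMap.continuous_iff]
  have : descend n g ∘ proj n = proj n ∘ g := funext (descend_proj hg)
  rw [this]
  exact (isOpenQuotientMap_proj n).continuous.comp g.continuous

variable (n) in
/-- Periodic homeomorphisms of the line act on the circle. -/
noncomputable def toCircle : periodic n →* (UnitAddCircle ≃ₜ UnitAddCircle) where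
  toFun g :=
    { toFun := descend n g.1
      invFun := descend n (g.1⁻¹ : ℝ ≃ₜ ℝ)
      left_inv := fun c => by
        obtain ⟨x, rfl⟩ := (isOpenQuotientMap_proj n).surjective c
        rw [descend_proj g.2, descend_proj (inv_mem g.2)]
        simp
      right_inv := fun c => by
        obtain ⟨x, rfl⟩ := (isOpenQuotientMap_proj n).surjective c
        rw [descend_proj (inv_mem g.2), descend_proj g.2]
        simp
      continuous_toFun := continuous_descend g.2
      continuous_invFun := continuous_descend (inv_mem g.2) }
  map_one' := by
    ext c
    obtain ⟨x, rfl⟩ := (isOpenQuotientMap_proj n).surjective c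
    exact descend_proj (one_mem _) x
  map_mul' a b := by
    ext c
    obtain ⟨x, rfl⟩ := (isOpenQuotientMap_proj n).surjective c
    exact (descend_proj (mul_mem a.2 b.2) x).trans
      ((congrArg (descend n a.1) (descend_proj b.2 x)).trans (descend_proj a.2 _)).symm

variable (n) in
/-- The action of the lifted group on the circle. -/
noncomputable def liftToCircle : liftGroup n →* (UnitAddCircle ≃ₜ UnitAddCircle) :=
  (toCircle n).comp (Subgroup.inclusion liftGroup_le_periodic)

theorem liftToCircle_proj (g : liftGroup n) (x : ℝ) :
    liftToCircle n g (proj n x) = proj n (g.1 x) :=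
  descend_proj (liftGroup_le_periodic g.2) x

/-- A kernel element shifts each point by a multiple of the period. At `0` the shift vanishes by
ping-pong, so all multiples of `2 n` are fixed and monotonicity leaves no room for a shift
elsewhere. -/
theorem liftToCircle_injective : Function.Injective (liftToCircle n) := by
  rw [injective_iff_map_eq_one]
  intro g hg
  have hp : ∀ x, ∃ j : ℤ, g.1 x = x + 2 * n * j := by
    intro x
    have := liftToCircle_proj g x
    rw [hg, Homeomorph.one_apply] at this
    exact proj_eq_iff.1 this
  have h3 := three_le_cast n
  have hmono := strictMono_of_mem g.2
  have h0 : g.1 0 = 0 := by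
    obtain ⟨j, hj⟩ := hp 0
    rw [zero_add] at hj
    rw [hj, eq_zero_of_translation g.2 hj]; simp
  have hper : ∀ i : ℤ, g.1 (2 * n * i) = 2 * n * i := by
    intro i
    have := periodic_add_mul (liftGroup_le_periodic g.2) 0 i
    rwa [h0, zero_add] at this
  apply Subtype.ext
  ext x
  obtain ⟨j, hj⟩ := hp x
  rw [hj]
  have hi0 := Int.floor_le (x / (2 * n))
  have hi1 := Int.lt_floor_add_one (x / (2 * n))
  rw [le_div_iff₀ (by linarith)] at hi0
  rw [div_lt_iff₀ (by linarith)] at hi1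
  generalize ⌊x / (2 * (n : ℝ))⌋ = i at *
  have e0 := hmono.monotone (show 2 * n * (i : ℝ) ≤ x by linarith)
  have e1 := hmono (show x < 2 * n * ((i + 1 : ℤ) : ℝ) by push_cast; linarith)
  rw [hper, hj] at e0 e1
  push_cast at e1
  have j0 : (-1 : ℝ) < j := by
    by_contra hcon
    push Not at hcon
    have : 2 * n * (j : ℝ) ≤ 2 * n * (-1) := by gcongr
    linarith
  have j1 : (j : ℝ) < 1 := by
    by_contra hcon
    push Not at hcon
    have : 2 * n * (1 : ℝ) ≤ 2 * n * j := by gcongr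
    linarith
  have j0' : -1 < j := by exact_mod_cast j0
  have j1' : j < 1 := by exact_mod_cast j1
  obtain rfl : j = 0 := by omega
  simp

end Circle

/-! ### The fast ring -/

section Ring

variable (n : ℕ) [hn : Fact (3 ≤ n)]

/-- The intervals of the ring. -/
noncomputable def interval (i : ZMod n) : Set UnitAddCircle :=
  proj n '' Ioo (2 * (i.val : ℝ)) (2 * i.val + 4)

/-- The homeomorphisms of the ring. -/
noncomputable def gen (i : ZMod n) : UnitAddCircle ≃ₜ UnitAddCircle :=
  liftToCircle n ⟨lift n i.val, lift_mem _⟩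

variable {n}

theorem val_intCast_eq (k : ℤ) : (((k : ZMod n).val : ℤ)) = k + n * (-(k / n)) := by
  have : NeZero n := ⟨by have := hn.out; omega⟩
  rw [ZMod.val_intCast, Int.emod_def]
  ring

theorem gen_intCast (k : ℤ) : gen n (k : ZMod n) = liftToCircle n ⟨lift n k, lift_mem _⟩ := by
  rw [gen]
  congr 2
  rw [val_intCast_eq, lift_add_mul]

theorem gen_proj (k : ℤ) (x : ℝ) : gen n (k : ZMod n) (proj n x) = proj n (lift n k x) := by
  rw [gen_intCast, liftToCircle_proj]

theorem proj_mem_interval {k : ℤ} {x : ℝ} :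
    proj n x ∈ interval n (k : ZMod n) ↔
      ∃ m j : ℤ, m = k + n * j ∧ 2 * (m : ℝ) < x ∧ x < 2 * m + 4 := by
  have hv := val_intCast_eq (n := n) k
  have hv' : (((k : ZMod n).val : ℝ)) = ((k + n * (-(k / n)) : ℤ) : ℝ) := by exact_mod_cast hv
  rw [interval, hv']
  generalize -(k / (n : ℤ)) = l
  constructor
  · rintro ⟨y, ⟨h0, h1⟩, hy⟩
    obtain ⟨j, hj⟩ := proj_eq_iff.1 hy
    refine ⟨k + n * (l + j), l + j, rfl, ?_, ?_⟩ <;> push_cast at h0 h1 ⊢ <;> linarith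
  · rintro ⟨m, j, rfl, h0, h1⟩
    refine ⟨x + 2 * n * ((l - j : ℤ) : ℝ), ⟨?_, ?_⟩, proj_add x _⟩ <;>
      push_cast at h0 h1 ⊢ <;> linarith

theorem proj_mem_interval_of_mem {k : ℤ} {x : ℝ} (h0 : 2 * (k : ℝ) < x) (h1 : x < 2 * k + 4) :
    proj n x ∈ interval n (k : ZMod n) :=
  proj_mem_interval.2 ⟨k, 0, by simp, h0, h1⟩

theorem interval_eq (k : ℤ) :
    interval n (k : ZMod n) = proj n '' Ioo (2 * (k : ℝ)) (2 * k + 4) := by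
  ext c
  obtain ⟨x, rfl⟩ := (isOpenQuotientMap_proj n).surjective c
  constructor
  · intro h
    obtain ⟨m, j, rfl, h0, h1⟩ := proj_mem_interval.1 h
    refine ⟨x + 2 * n * ((-j : ℤ) : ℝ), ⟨?_, ?_⟩, proj_add x _⟩ <;>
      push_cast at h0 h1 ⊢ <;> linarith
  · rintro ⟨y, ⟨h0, h1⟩, hy⟩
    rw [← hy]
    exact proj_mem_interval_of_mem h0 h1

/-- Points of a fundamental domain covering no point of an interval. -/
theorem proj_notMem_interval {k : ℤ} {x : ℝ} (h0 : 2 * (k : ℝ) + 4 ≤ x)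
    (h1 : x ≤ 2 * k + 2 * n) : proj n x ∉ interval n (k : ZMod n) := by
  rw [proj_mem_interval]
  rintro ⟨m, j, rfl, h2, h3⟩
  push_cast at h2 h3
  have hpos := three_le_cast n
  have j0 : 0 < j := by
    by_contra hcon
    have : (j : ℝ) ≤ 0 := by exact_mod_cast not_lt.1 hcon
    have := mul_nonpos_of_nonneg_of_nonpos (by linarith : (0 : ℝ) ≤ n) this
    linarith
  have j1 : (1 : ℝ) ≤ j := by exact_mod_cast j0
  have : (n : ℝ) * 1 ≤ n * j := by gcongr
  linarith

theorem isOpen_interval (i : ZMod n) : IsOpen (interval n i) :=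
  (isOpenQuotientMap_proj n).isOpenMap _ isOpen_Ioo

theorem isConnected_interval (i : ZMod n) : IsConnected (interval n i) :=
  (isConnected_Ioo (by linarith)).image _ (isOpenQuotientMap_proj n).continuous.continuousOn

theorem inter_interval (k : ℤ) : interval n (k : ZMod n) ∩ interval n ((k : ZMod n) + 1) =
    proj n '' Ioo (2 * (k : ℝ) + 2) (2 * k + 4) := by
  have hk : ((k : ZMod n) + 1) = ((k + 1 : ℤ) : ZMod n) := by push_cast; rfl
  have h3 := three_le_cast n
  rw [hk]
  apply Subset.antisymm
  · rintro c ⟨hc, hc'⟩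
    rw [interval_eq] at hc
    obtain ⟨x, ⟨h0, h1⟩, rfl⟩ := hc
    refine ⟨x, ⟨?_, h1⟩, rfl⟩
    by_contra hcon
    push Not at hcon
    -- One period higher, `x` lies in the part of the fundamental domain at `2 (k + 1)` that misses
    -- the interval.
    have := proj_add (n := n) x 1
    rw [← this] at hc'
    exact proj_notMem_interval (n := n) (by push_cast; linarith) (by push_cast; linarith) hc'
  · rintro _ ⟨x, ⟨h0, h1⟩, rfl⟩
    exact ⟨proj_mem_interval_of_mem (by linarith) h1,
      proj_mem_interval_of_mem (by push_cast; linarith) (by push_cast; linarith)⟩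

theorem gen_fixes {i : ZMod n} {c : UnitAddCircle} (hc : c ∉ interval n i) : gen n i c = c := by
  obtain ⟨k, rfl⟩ := ZMod.intCast_surjective i
  obtain ⟨x, rfl⟩ := (isOpenQuotientMap_proj n).surjective c
  have h0 := cell_le n k x
  have h1 := lt_cell_add n k x
  rw [gen_proj, lift_eq_cell k x]
  rw [proj_mem_interval] at hc
  have hm : cell n k x = k + n * ⌊(x - 2 * k) / (2 * n)⌋ := rfl
  generalize cell n k x = m at *
  rcases le_or_gt (2 * (m : ℝ) + 4) x with h4 | h4
  · rw [lift_fixed n h4 h1.le]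
  rcases h0.eq_or_lt with h0 | h0
  · rw [← h0, lift_fixed_left]
  · exact absurd ⟨m, _, hm, h0, h4⟩ hc

theorem gen_moves {i : ZMod n} {c : UnitAddCircle} (hc : c ∈ interval n i) : gen n i c ≠ c := by
  obtain ⟨k, rfl⟩ := ZMod.intCast_surjective i
  have h3 := three_le_cast n
  rw [interval_eq] at hc
  obtain ⟨x, ⟨h0, h1⟩, rfl⟩ := hc
  rw [gen_proj, ne_comm, Ne, proj_eq_iff]
  rintro ⟨j, hj⟩
  have h4 := lt_lift n h0 h1
  have h5 := lift_strictMono n k h1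
  rw [lift_fixed n le_rfl (by linarith), hj] at h5
  rw [hj] at h4
  have j0 : (0 : ℝ) < j := by
    by_contra hcon
    have := mul_nonpos_of_nonneg_of_nonpos (by linarith : (0 : ℝ) ≤ 2 * n) (not_lt.1 hcon)
    linarith
  have j1 : (1 : ℝ) ≤ j := by
    have : 0 < j := by exact_mod_cast j0
    exact_mod_cast this
  have : 2 * (n : ℝ) * 1 ≤ 2 * n * j := by gcongr
  linarith

theorem disjoint_interval {i j : ZMod n} (h0 : j ≠ i) (h1 : j ≠ i + 1) (h2 : i ≠ j + 1) :
    Disjoint (interval n i) (interval n j) := by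
  obtain ⟨k, rfl⟩ := ZMod.intCast_surjective i
  obtain ⟨l, rfl⟩ := ZMod.intCast_surjective j
  rw [disjoint_left]
  intro c hc hc'
  rw [interval_eq] at hc
  obtain ⟨x, ⟨h3, h4⟩, rfl⟩ := hc
  obtain ⟨m, r, hm, h5, h6⟩ := proj_mem_interval.1 hc'
  have hml : (m : ZMod n) = l := by rw [hm]; push_cast; simp
  rw [← hml] at h0 h1 h2
  have e0 : k < m + 2 := by have : (k : ℝ) < m + 2 := by linarith
                            exact_mod_cast this
  have e1 : m < k + 2 := by have : (m : ℝ) < k + 2 := by linarith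
                            exact_mod_cast this
  have : m = k ∨ m = k + 1 ∨ k = m + 1 := by omega
  rcases this with rfl | rfl | rfl
  · exact h0 rfl
  · exact h1 (by push_cast; rfl)
  · exact h2 (by push_cast; rfl)

theorem isRing_interval : LineAction.IsRing n (interval n) (gen n) where
  isOpen := isOpen_interval
  isConnected := isConnected_interval
  cover := by
    rw [eq_univ_iff_forall]
    intro c
    obtain ⟨x, rfl⟩ := (isOpenQuotientMap_proj n).surjective c
    have h0 := Int.floor_le (x / 2)
    have h1 := Int.lt_floor_add_one (x / 2)
    exact mem_iUnion.2 ⟨((⌊x / 2⌋ - 1 : ℤ) : ZMod n),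
      proj_mem_interval_of_mem (by push_cast; linarith) (by push_cast; linarith)⟩
  disjoint := fun i j => disjoint_interval
  inter_connected := fun i => by
    obtain ⟨k, rfl⟩ := ZMod.intCast_surjective i
    rw [inter_interval]
    exact (isConnected_Ioo (by linarith)).image _
      (isOpenQuotientMap_proj n).continuous.continuousOn
  inter_proper := fun i => by
    obtain ⟨k, rfl⟩ := ZMod.intCast_surjective i
    have hk : ((k : ZMod n) + 1) = ((k + 1 : ℤ) : ZMod n) := by push_cast; rfl
    have h3 := three_le_cast n
    constructor
    · refine ⟨inter_subset_left, fun h => ?_⟩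
      have h1 : proj n (2 * k + 1) ∈ interval n (k : ZMod n) :=
        proj_mem_interval_of_mem (by linarith) (by linarith)
      have h2 := (h h1).2
      rw [hk, ← proj_add _ 1] at h2
      exact proj_notMem_interval (n := n) (by push_cast; linarith) (by push_cast; linarith) h2
    · refine ⟨inter_subset_right, fun h => ?_⟩
      have h1 : proj n (2 * k + 5) ∈ interval n ((k : ZMod n) + 1) := by
        rw [hk]
        exact proj_mem_interval_of_mem (by push_cast; linarith) (by push_cast; linarith)
      exact proj_notMem_interval (n := n) (by linarith) (by linarith) (h h1).1
  support := fun i => by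
    ext c
    exact ⟨gen_moves, fun h => by_contra fun hc => h (gen_fixes hc)⟩

/-- The right foot of one bump lies where the next bump contracts into its own right foot, so the
track passes from right foot to right foot. -/
theorem track_gen (k : ℤ) (l : ℕ) : ∃ y : ℝ, 2 * ((k + l : ℤ) : ℝ) + 3 < y ∧
    y < 2 * ((k + l : ℤ) : ℝ) + 4 ∧
    LineAction.track (gen n) (k : ZMod n) (proj n (2 * k + 2)) l = proj n y := by
  induction l with
  | zero =>
    have h := lift_contract n (m := k) (x := 2 * k + 2) (by linarith) (by linarith)
    refine ⟨lift n k (2 * k + 2), ?_, ?_, gen_proj k _⟩ <;> rw [h] <;> push_cast <;> linarith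
  | succ l ih =>
    obtain ⟨y, h0, h1, hy⟩ := ih
    have hk : (k : ZMod n) + ((l + 1 : ℕ) : ZMod n) = ((k + l + 1 : ℤ) : ZMod n) := by
      push_cast; ring
    push_cast at h0 h1
    have h := lift_contract n (m := k + l + 1) (x := y) (by push_cast; linarith)
      (by push_cast; linarith)
    refine ⟨lift n (k + l + 1) y, ?_, ?_, ?_⟩
    · rw [h]; push_cast; linarith
    · rw [h]; push_cast; linarith
    · rw [LineAction.track, hy, hk, gen_proj]

/-- Inside interval `k`, points left of `2 k + 2` have a neighbourhood missing the next interval,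
and points right of it belong to that open interval. -/
theorem eq_of_mem_frontier {k : ℤ} {c : UnitAddCircle} (hc : c ∈ interval n (k : ZMod n))
    (hc' : c ∈ frontier (interval n ((k : ZMod n) + 1))) : c = proj n (2 * k + 2) := by
  have hk : ((k : ZMod n) + 1) = ((k + 1 : ℤ) : ZMod n) := by push_cast; rfl
  have h3 := three_le_cast n
  have hnot : c ∉ interval n ((k : ZMod n) + 1) := by
    rw [(isOpen_interval _).frontier_eq] at hc'
    exact hc'.2
  have hcl := frontier_subset_closure hc'
  rw [interval_eq] at hc
  obtain ⟨x, ⟨h0, h1⟩, rfl⟩ := hc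
  rcases lt_trichotomy x (2 * k + 2) with h | h | h
  · exfalso
    obtain ⟨_, ⟨y, ⟨hy0, hy1⟩, rfl⟩, hy⟩ := mem_closure_iff.1 hcl
      (proj n '' Ioo (2 * (k : ℝ)) (2 * k + 2)) ((isOpenQuotientMap_proj n).isOpenMap _ isOpen_Ioo)
      ⟨x, ⟨h0, h⟩, rfl⟩
    rw [hk, ← proj_add _ 1] at hy
    exact proj_notMem_interval (n := n) (by push_cast; linarith) (by push_cast; linarith) hy
  · rw [h]
  · rw [hk] at hnot
    exact absurd (proj_mem_interval_of_mem (by push_cast; linarith) (by push_cast; linarith)) hnot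

theorem isFastRing_interval : LineAction.IsFastRing n (interval n) (gen n) := by
  refine ⟨isRing_interval, fun i c hc l _ _ => ?_⟩
  obtain ⟨k, rfl⟩ := ZMod.intCast_surjective i
  rw [eq_of_mem_frontier hc.1 hc.2]
  obtain ⟨y, h0, h1, hy⟩ := track_gen (n := n) k l
  have hk : (k : ZMod n) + (l : ZMod n) + 1 = ((k + l + 1 : ℤ) : ZMod n) := by push_cast; ring
  rw [hy, hk]
  push_cast at h0 h1
  exact proj_mem_interval_of_mem (by push_cast; linarith) (by push_cast; linarith)

end Ring

/-! ### The ring group, its derived subgroup and the type (ii) action -/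

section RingGroup

variable {n : ℕ} [hn : Fact (3 ≤ n)]

theorem range_liftToCircle : (liftToCircle n).range = LineAction.ringGroup (gen n) := by
  have htop : Subgroup.closure ((Subtype.val : liftGroup n → _) ⁻¹' range (lift n)) = ⊤ :=
    Subgroup.closure_closure_coe_preimage
  rw [MonoidHom.range_eq_map, ← htop, MonoidHom.map_closure]
  congr 1
  ext g
  constructor
  · rintro ⟨⟨a, ha⟩, ⟨k, hk⟩, rfl⟩
    obtain rfl : lift n k = a := hk
    exact ⟨(k : ZMod n), gen_intCast k⟩
  · rintro ⟨i, rfl⟩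
    exact ⟨⟨lift n i.val, lift_mem _⟩, ⟨_, rfl⟩, rfl⟩

variable (n) in
/-- The ring group is isomorphic to its lift to the line. -/
noncomputable def liftEquiv : liftGroup n ≃* LineAction.ringGroup (gen n) :=
  (MonoidHom.ofInjective liftToCircle_injective).trans
    (MulEquiv.subgroupCongr range_liftToCircle)

variable (n) in
/-- The tautological action of the ring group on the circle. -/
noncomputable def circleAction : LineAction.ringGroup (gen n) →* (UnitAddCircle ≃ₜ UnitAddCircle) :=
  (LineAction.ringGroup (gen n)).subtype

variable (n) in
/-- The lifted action of the ring group on the line. -/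
noncomputable def lineAction : LineAction.ringGroup (gen n) →* (ℝ ≃ₜ ℝ) :=
  (liftGroup n).subtype.comp (liftEquiv n).symm.toMonoidHom

theorem lineAction_mem (g : LineAction.ringGroup (gen n)) : lineAction n g ∈ liftGroup n :=
  ((liftEquiv n).symm g).2

theorem exists_lineAction_eq {h : ℝ ≃ₜ ℝ} (hh : h ∈ liftGroup n) :
    ∃ g, lineAction n g = h :=
  ⟨liftEquiv n ⟨h, hh⟩, by simp [lineAction]⟩

theorem lineAction_injective : Function.Injective (lineAction n) :=
  (Subtype.val_injective).comp (liftEquiv n).symm.injective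

theorem circleAction_proj (g : LineAction.ringGroup (gen n)) (x : ℝ) :
    circleAction n g (proj n x) = proj n (lineAction n g x) := by
  obtain ⟨h, rfl⟩ := (liftEquiv n).surjective g
  have : lineAction n (liftEquiv n h) = h := by simp [lineAction]
  rw [this]
  exact liftToCircle_proj h x

variable (n) in
/-- The generators of the ring group. -/
noncomputable def ringGen (i : ZMod n) : LineAction.ringGroup (gen n) :=
  ⟨gen n i, Subgroup.subset_closure ⟨i, rfl⟩⟩

theorem closure_ringGen : Subgroup.closure (range (ringGen n)) = ⊤ := by
  rw [← Subgroup.closure_closure_coe_preimage]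
  congr 1
  ext g
  constructor
  · rintro ⟨i, rfl⟩
    exact ⟨i, rfl⟩
  · rintro ⟨i, hi⟩
    exact ⟨i, Subtype.ext hi⟩

theorem lineAction_ringGen (k : ℤ) : lineAction n (ringGen n (k : ZMod n)) = lift n k := by
  have : ringGen n (k : ZMod n) = liftEquiv n ⟨lift n k, lift_mem _⟩ :=
    Subtype.ext (gen_intCast k)
  rw [this]
  simp [lineAction]

theorem circleAction_injective : Function.Injective (circleAction n) := Subtype.val_injective

theorem infinite_of_isOpen {U : Set UnitAddCircle} (hU : IsOpen U) (hne : U.Nonempty) :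
    U.Infinite := by
  obtain ⟨c, hc⟩ := hne
  have : Nontrivial UnitAddCircle := by
    refine ⟨((1 / 2 : ℝ) : UnitAddCircle), 0, fun h => ?_⟩
    obtain ⟨j, hj⟩ := AddCircle.coe_eq_zero_iff (1 : ℝ) |>.1 h
    rw [zsmul_eq_mul, mul_one] at hj
    have : (2 * j : ℝ) = 1 := by linarith
    have : 2 * j = 1 := by exact_mod_cast this
    omega
  exact infinite_of_mem_nhds c (hU.mem_nhds hc)

theorem exists_proj_Ioo_subset {U : Set UnitAddCircle} (hU : IsOpen U) (hne : U.Nonempty) :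
    ∃ p q : ℝ, p < q ∧ q ≤ p + 2 * n ∧ proj n '' Ioo p q ⊆ U := by
  have h3 := three_le_cast n
  obtain ⟨c, hc⟩ := hne
  obtain ⟨x, rfl⟩ := (isOpenQuotientMap_proj n).surjective c
  have hpre : proj n ⁻¹' U ∈ 𝓝 x :=
    (hU.preimage (isOpenQuotientMap_proj n).continuous).mem_nhds hc
  obtain ⟨ε, hε, hball⟩ := Metric.mem_nhds_iff.1 hpre
  refine ⟨x, x + min ε 1, by simp [hε], by linarith [min_le_right ε 1], ?_⟩
  rintro _ ⟨y, ⟨h0, h1⟩, rfl⟩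
  apply hball
  rw [Metric.mem_ball, Real.dist_eq, abs_lt]
  constructor <;> linarith [min_le_left ε 1]

/-- Off an arc covered by `(v, u)`, every point has a lift in `[u - 2 n, v]`, which is shorter than
the period. -/
theorem isCompressing_circleAction : IsCompressing (circleAction n) := by
  intro U V hU hUne hV hVne
  obtain ⟨v, u, hvu, huv, hUs⟩ := exists_proj_Ioo_subset (n := n) hU hUne
  obtain ⟨p, q, hpq, -, hVs⟩ := exists_proj_Ioo_subset (n := n) hV hVne
  obtain ⟨h, hh, h0, h1⟩ := exists_compress (n := n) (u := u - 2 * n) (v := v) (by linarith) hpq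
  obtain ⟨g, rfl⟩ := exists_lineAction_eq hh
  refine ⟨g, fun c hc => ?_⟩
  obtain ⟨x, rfl⟩ := (isOpenQuotientMap_proj n).surjective c
  have h3 := three_le_cast n
  -- move `x` into the fundamental domain `[u - 2 n, u)`
  obtain ⟨j, hj⟩ : ∃ j : ℤ, j = -⌊(x - (u - 2 * n)) / (2 * n)⌋ := ⟨_, rfl⟩
  have hf0 := Int.floor_le ((x - (u - 2 * n)) / (2 * n))
  have hf1 := Int.lt_floor_add_one ((x - (u - 2 * n)) / (2 * n))
  rw [le_div_iff₀ (by linarith)] at hf0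
  rw [div_lt_iff₀ (by linarith)] at hf1
  rw [← proj_add x j] at hc ⊢
  have hj' : ((⌊(x - (u - 2 * n)) / (2 * n)⌋ : ℤ) : ℝ) = -j := by rw [hj]; push_cast; ring
  rw [hj'] at hf0 hf1
  set y := x + 2 * n * j
  have hy0 : u - 2 * n ≤ y := by simp only [y]; linarith
  have hy1 : y < u := by simp only [y]; linarith
  have hyv : y ≤ v := by
    by_contra hcon
    exact hc (hUs ⟨y, ⟨not_le.1 hcon, hy1⟩, rfl⟩)
  rw [circleAction_proj]
  have hmono := strictMono_of_mem (lineAction_mem g)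
  exact hVs ⟨_, ⟨h0.trans_le (hmono.monotone hy0), (hmono.monotone hyv).trans_lt h1⟩, rfl⟩

variable (n) in
/-- An open set of points fixed by the `i`-th generator. -/
noncomputable def gap (i : ZMod n) : Set UnitAddCircle :=
  proj n '' Ioo (2 * (i.val : ℝ) + 4) (2 * i.val + 6)

theorem isOpen_gap (i : ZMod n) : IsOpen (gap n i) :=
  (isOpenQuotientMap_proj n).isOpenMap _ isOpen_Ioo

theorem ringGen_mem_fixer (i : ZMod n) :
    ringGen n i ∈ fixer (circleAction n) ((interval n i)ᶜ) := fun _ hc => gen_fixes hc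

theorem gap_subset (i : ZMod n) : gap n i ⊆ (interval n i)ᶜ := by
  have : NeZero n := ⟨by have := hn.out; omega⟩
  have h3 := three_le_cast n
  rintro _ ⟨x, ⟨h0, h1⟩, rfl⟩ hc
  have hi : (((i.val : ℤ)) : ZMod n) = i := by simp
  rw [← hi] at hc
  exact proj_notMem_interval (n := n) (by push_cast; linarith) (by push_cast; linarith) hc

theorem ringGen_mem_fixer_gap (i : ZMod n) : ringGen n i ∈ fixer (circleAction n) (gap n i) :=
  fixer_anti (gap_subset i) (ringGen_mem_fixer i)

theorem not_commute_ringGen : ∃ a b : LineAction.ringGroup (gen n), ¬ Commute a b := by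
  refine ⟨ringGen n ((0 : ℤ) : ZMod n), ringGen n ((1 : ℤ) : ZMod n), fun h => ?_⟩
  -- The point `2` is fixed by generator `1`, while generator `0` moves it to `10 / 3`, inside the
  -- support of generator `1`.
  have h1 : gen n ((0 : ℤ) : ZMod n) (gen n ((1 : ℤ) : ZMod n) (proj n 2)) =
      gen n ((1 : ℤ) : ZMod n) (gen n ((0 : ℤ) : ZMod n) (proj n 2)) :=
    DFunLike.congr_fun (congrArg Subtype.val h.eq) (proj n 2)
  have e1 : lift n 1 2 = 2 := by simpa using lift_fixed_left n 1
  have e2 : lift n 0 2 = 10 / 3 := by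
    rw [lift_contract n (by norm_num) (by norm_num)]; norm_num
  rw [gen_proj 1, e1, gen_proj 0, e2] at h1
  exact gen_moves (proj_mem_interval_of_mem (by norm_num) (by norm_num)) h1.symm

theorem lift_right_of_le {k : ℤ} {x : ℝ} (h0 : 2 * (k : ℝ) + 2 < x) (h1 : x < 2 * k + 6) :
    2 * (k : ℝ) + 3 < lift n k x ∧ lift n k x < 2 * k + 6 := by
  have h3 := three_le_cast n
  rcases le_total x (2 * k + 4) with h | h
  · rw [lift_contract n (by linarith) h]; constructor <;> linarith
  · rw [lift_fixed n h (by linarith)]; constructor <;> linarith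

theorem ringGen_succ_apply_notMem {k : ℤ} {x : ℝ} (h0 : 2 * (k : ℝ) + 3 < x)
    (h1 : x < 2 * k + 6) :
    gen n ((k + 1 : ℤ) : ZMod n) (proj n x) ∉ interval n (k : ZMod n) := by
  have h3 := three_le_cast n
  rw [gen_proj]
  have := lift_contract n (m := k + 1) (x := x) (by push_cast; linarith) (by push_cast; linarith)
  push_cast at this
  refine proj_notMem_interval ?_ ?_ <;> rw [this] <;> linarith

/-- Two of the Thompson relations hold in the group itself, since `g * f` and `g * (f * f)` push the
support of `g` off that of `f`. The third holds modulo local commutators, its two elements having a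
common open set of fixed points. -/
theorem ringGen_commutator_succ (k : ℤ) :
    ⁅ringGen n (k : ZMod n), ringGen n ((k + 1 : ℤ) : ZMod n)⁆ ∈
      localCommutator (circleAction n) := by
  set f := ringGen n (k : ZMod n) with hf
  set g := ringGen n ((k + 1 : ℤ) : ZMod n) with hg
  have h3 := three_le_cast n
  have aux : ∀ h : LineAction.ringGroup (gen n),
      (∀ c, c ∈ interval n ((k + 1 : ℤ) : ZMod n) →
        circleAction n h c ∉ interval n (k : ZMod n)) → Commute f (h * g * h⁻¹) := by
    intro h hh
    refine commute_of_fixer circleAction_injective (ringGen_mem_fixer _)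
      (conj_mem_fixer (ringGen_mem_fixer _) (T := (interval n (k : ZMod n))ᶜ) fun c hc =>
        hh c (by simpa using hc)) disjoint_compl_right
  have a1 : ∀ c, c ∈ interval n ((k + 1 : ℤ) : ZMod n) →
      circleAction n (g * f) c ∉ interval n (k : ZMod n) := by
    intro c hc
    rw [interval_eq] at hc
    obtain ⟨x, ⟨h0, h1⟩, rfl⟩ := hc
    push_cast at h0 h1
    obtain ⟨h4, h5⟩ := lift_right_of_le (n := n) (k := k) (x := x) (by linarith) (by linarith)
    have : circleAction n (g * f) (proj n x) =
        gen n ((k + 1 : ℤ) : ZMod n) (gen n (k : ZMod n) (proj n x)) := rfl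
    rw [this, gen_proj]
    exact ringGen_succ_apply_notMem h4 h5
  have a2 : ∀ c, c ∈ interval n ((k + 1 : ℤ) : ZMod n) →
      circleAction n (g * (f * f)) c ∉ interval n (k : ZMod n) := by
    intro c hc
    rw [interval_eq] at hc
    obtain ⟨x, ⟨h0, h1⟩, rfl⟩ := hc
    push_cast at h0 h1
    obtain ⟨h4, h5⟩ := lift_right_of_le (n := n) (k := k) (x := x) (by linarith) (by linarith)
    obtain ⟨h6, h7⟩ := lift_right_of_le (n := n) (k := k) (x := lift n k x) (by linarith) h5
    have : circleAction n (g * (f * f)) (proj n x) =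
        gen n ((k + 1 : ℤ) : ZMod n) (gen n (k : ZMod n) (gen n (k : ZMod n) (proj n x))) := rfl
    rw [this, gen_proj, gen_proj]
    exact ringGen_succ_apply_notMem h6 h7
  -- the interval `[2 k + 4, 2 k + 6]` is fixed by `f` and invariant under `g`
  set O : Set UnitAddCircle := proj n '' Ioo (2 * (k : ℝ) + 4) (2 * k + 6) with hO
  have hfO : ∀ c ∈ O, circleAction n f c = c := by
    rintro _ ⟨x, ⟨h0, h1⟩, rfl⟩
    exact ringGen_mem_fixer _ _ (proj_notMem_interval h0.le (by linarith))
  have hgO : ∀ c ∈ O, circleAction n g c ∈ O := by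
    rintro _ ⟨x, ⟨h0, h1⟩, rfl⟩
    have e := lift_contract n (m := k + 1) (x := x) (by push_cast; linarith)
      (by push_cast; linarith)
    push_cast at e
    refine ⟨lift n (k + 1) x, ⟨?_, ?_⟩, (gen_proj (k + 1) x).symm⟩ <;> rw [e] <;> linarith
  have hfinv : f⁻¹ ∈ fixer (circleAction n) O := inv_mem hfO
  have hd : g⁻¹ * (f * g * f⁻¹) ∈ fixer (circleAction n) O := by
    intro c hc
    rw [map_mul, map_mul, map_mul]
    simp only [Homeomorph.mul_apply]
    rw [hfinv c hc, hfO _ (hgO c hc), inv_apply_apply]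
  have hd1 : f * (g⁻¹ * (f * g * f⁻¹)) * f⁻¹ ∈ fixer (circleAction n) O :=
    mul_mem (mul_mem hfO hd) hfinv
  have hmem : ⁅g⁻¹ * (f * g * f⁻¹), f * (g⁻¹ * (f * g * f⁻¹)) * f⁻¹⁆ ∈
      localCommutator (circleAction n) :=
    Subgroup.subset_closure ⟨O, _, _, (isOpenQuotientMap_proj n).isOpenMap _ isOpen_Ioo,
      (nonempty_Ioo.2 (by linarith)).image _, hd, hd1, rfl⟩
  set π := QuotientGroup.mk' (localCommutator (circleAction n)) with hπ
  have hπ1 : ∀ x, x ∈ localCommutator (circleAction n) ↔ π x = 1 := fun x =>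
    (QuotientGroup.eq_one_iff x).symm
  rw [hπ1, map_commutatorElement, commutatorElement_eq_one_iff_commute] at hmem ⊢
  refine commute_of_thompson_relations ?_ ?_ ?_
  · have h := (aux _ a1).map π
    simp only [map_mul, map_inv, mul_inv_rev] at h ⊢
    simpa only [mul_assoc] using h
  · have h := (aux _ a2).map π
    simp only [map_mul, map_inv, mul_inv_rev] at h ⊢
    simpa only [mul_assoc] using h
  · simpa only [map_mul, map_inv] using hmem

theorem ringGen_commutator_mem (i j : ZMod n) :
    ⁅ringGen n i, ringGen n j⁆ ∈ localCommutator (circleAction n) := by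
  have hsucc : ∀ i : ZMod n, ⁅ringGen n i, ringGen n (i + 1)⁆ ∈
      localCommutator (circleAction n) := by
    intro i
    obtain ⟨k, rfl⟩ := ZMod.intCast_surjective i
    have := ringGen_commutator_succ (n := n) k
    push_cast at this
    exact this
  by_cases h0 : j = i
  · rw [h0, commutatorElement_self]; exact one_mem _
  by_cases h1 : j = i + 1
  · rw [h1]; exact hsucc i
  by_cases h2 : i = j + 1
  · rw [h2, ← commutatorElement_inv]; exact inv_mem (hsucc j)
  · have : Commute (ringGen n i) (ringGen n j) :=
      commute_of_fixer circleAction_injective (ringGen_mem_fixer i) (ringGen_mem_fixer j)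
        (disjoint_interval h0 h1 h2)
    rw [commutatorElement_eq_one_iff_commute.2 this]
    exact one_mem _

theorem fg_ringDerivedGroup : Group.FG (LineAction.ringDerivedGroup (gen n)) := by
  have : NeZero n := ⟨by have := hn.out; omega⟩
  exact fg_commutator_of_isCompressing circleAction_injective (fun _ => infinite_of_isOpen)
    isCompressing_circleAction closure_ringGen (gap n) isOpen_gap
    (fun _ => (nonempty_Ioo.2 (by linarith)).image _)
    ringGen_mem_fixer_gap

theorem isSimpleGroup_ringDerivedGroup :
    IsSimpleGroup (LineAction.ringDerivedGroup (gen n)) :=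
  isSimpleGroup_commutator_of_isCompressing circleAction_injective (fun _ => infinite_of_isOpen)
    isCompressing_circleAction closure_ringGen (gap n) isOpen_gap
    (fun _ => (nonempty_Ioo.2 (by linarith)).image _)
    ringGen_mem_fixer_gap ringGen_commutator_mem not_commute_ringGen

/-- The derived subgroup moves any interval shorter than the period into any open interval. -/
theorem exists_compress_derived {u v p q : ℝ} (huv : u ≤ v) (hv : v < u + 2 * n) (hpq : p < q) :
    ∃ g : LineAction.ringDerivedGroup (gen n), p < lineAction n g u ∧ lineAction n g v < q := by
  obtain ⟨h, hh, h0, h1⟩ := exists_compress (n := n) hv hpq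
  obtain ⟨g, rfl⟩ := exists_lineAction_eq hh
  have hmono := (strictMono_of_mem (lineAction_mem g)).monotone
  set W := fixer (lineAction n) (Icc (lineAction n g u) (lineAction n g v)) with hW
  -- The compressed interval can be moved into `(2 k + 4, 2 k + 6)`, where generator `k` is trivial,
  -- so a conjugate of each generator fixes it pointwise.
  obtain ⟨w, hw, hwg⟩ := exists_mul_mem_commutator (closure_ringGen (n := n)) W (fun i => by
    obtain ⟨k, rfl⟩ := ZMod.intCast_surjective i
    have hlt : lineAction n g v < lineAction n g u + 2 * n := by
      rw [← (liftGroup_le_periodic (lineAction_mem g)).2]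
      exact strictMono_of_mem (lineAction_mem g) hv
    have h3 := three_le_cast n
    obtain ⟨r, hr, hr0, hr1⟩ := exists_compress (n := n) hlt
      (p := 2 * (k : ℝ) + 4) (q := 2 * k + 6) (by linarith)
    obtain ⟨s, rfl⟩ := exists_lineAction_eq hr
    have hsm := (strictMono_of_mem (lineAction_mem s)).monotone
    refine ⟨s⁻¹, fun x hx => ?_⟩
    have e : lineAction n (ringGen n (k : ZMod n)) (lineAction n s x) = lineAction n s x := by
      rw [lineAction_ringGen]
      exact lift_fixed n (hr0.le.trans (hsm hx.1)) ((hsm hx.2).trans (by linarith))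
    rw [inv_inv, map_mul, map_mul, Homeomorph.mul_apply, Homeomorph.mul_apply, e,
      inv_apply_apply]) g
  refine ⟨⟨w * g, hwg⟩, ?_, ?_⟩
  · rw [map_mul, Homeomorph.mul_apply, hw _ ⟨le_rfl, hmono huv⟩]; exact h0
  · rw [map_mul, Homeomorph.mul_apply, hw _ ⟨hmono huv, le_rfl⟩]; exact h1

variable (n) in
/-- The action of the derived subgroup on the line. -/
noncomputable def derivedLineAction : LineAction.ringDerivedGroup (gen n) →* (ℝ ≃ₜ ℝ) :=
  (lineAction n).comp (LineAction.ringDerivedGroup (gen n)).subtype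

theorem derivedLineAction_apply (g : LineAction.ringDerivedGroup (gen n)) (x : ℝ) :
    derivedLineAction n g x = lineAction n g x := rfl

theorem isTypeTwo_derivedLineAction : LineAction.IsTypeTwo (derivedLineAction n) := by
  have h3 := three_le_cast n
  have hop : LineAction.IsOrientationPreserving (derivedLineAction n) := fun g =>
    strictMono_of_mem (lineAction_mem (g : LineAction.ringGroup (gen n)))
  -- The action is already minimal, so the semiconjugacy is the identity; the contraction threshold
  -- is the period.
  refine ⟨hop, fun x => ?_, derivedLineAction n, hop,
    ⟨id, continuous_id, monotone_id, Function.surjective_id, fun _ _ => rfl⟩, fun x => ?_,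
    ⟨2 * n, by linarith, fun a b hab hlt => ?_⟩, fun hglob => ?_⟩
  · obtain ⟨g, h0, -⟩ := exists_compress_derived (n := n) (u := x) (v := x) le_rfl (by linarith)
      (show x + 1 < x + 2 by linarith)
    refine ⟨g, fun h => ?_⟩
    rw [derivedLineAction_apply] at h
    linarith
  · rw [dense_iff_exists_between]
    intro p q hpq
    obtain ⟨g, h0, h1⟩ := exists_compress_derived (n := n) (u := x) (v := x) le_rfl
      (by linarith) hpq
    exact ⟨_, ⟨g, rfl⟩, h0, h1⟩
  · choose g hg0 hg1 using fun k : ℕ => exists_compress_derived (n := n) hab.le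
      (by linarith : b < a + 2 * n) (show (0 : ℝ) < 1 / ((k : ℝ) + 1) by positivity)
    refine ⟨g, 0, fun U hU => ?_⟩
    obtain ⟨ε, hε, hball⟩ := Metric.mem_nhds_iff.1 hU
    filter_upwards [tendsto_one_div_add_atTop_nhds_zero_nat.eventually_lt_const hε] with k hk
    rintro _ ⟨x, hx, rfl⟩
    have e0 := (hop (g k)).monotone hx.1
    have e1 := (hop (g k)).monotone hx.2
    rw [derivedLineAction_apply, derivedLineAction_apply] at e0 e1
    apply hball
    rw [Metric.mem_ball, Real.dist_eq, sub_zero, abs_lt, derivedLineAction_apply]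
    have := hg0 k
    have := hg1 k
    constructor <;> linarith
  -- By periodicity every image of `[0, 2 n]` has length `2 n`, too long for a ball of radius `1`.
  · obtain ⟨g, p, hg⟩ := hglob 0 (2 * n) (by linarith)
    obtain ⟨k, hk⟩ := (hg _ (Metric.ball_mem_nhds p one_pos)).exists
    have e0 := hk ⟨0, ⟨le_rfl, by linarith⟩, rfl⟩
    have e1 := hk ⟨2 * n, ⟨by linarith, le_rfl⟩, rfl⟩
    have hper := (liftGroup_le_periodic
      (lineAction_mem (g k : LineAction.ringGroup (gen n)))).2 0
    rw [zero_add] at hper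
    rw [derivedLineAction_apply, Metric.mem_ball, Real.dist_eq, abs_lt] at e0 e1
    rw [hper] at e1
    linarith [e0.1, e1.2]

end RingGroup

/-! ### Left orders from actions on the line -/

section Order

/-- A group acting faithfully on the line by increasing homeomorphisms is left orderable. -/
theorem isLeftOrderable_of_action {G : Type*} [Group G] (ρ : G →* (ℝ ≃ₜ ℝ))
    (hρ : Function.Injective ρ) (hop : LineAction.IsOrientationPreserving ρ) :
    LineAction.IsLeftOrderable G := by
  classical
  -- Elements are compared at the first point of a dense sequence where they differ; by continuity
  -- and faithfulness distinct elements do differ somewhere on it.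
  obtain ⟨e, he⟩ := TopologicalSpace.exists_dense_seq ℝ
  let F : G → Lex (ℕ → ℝ) := fun g => toLex fun k => ρ g (e k)
  have hF : Function.Injective F := by
    intro a b hab
    apply hρ
    have h1 : (fun k => ρ a (e k)) = fun k => ρ b (e k) := toLex.injective hab
    ext x
    have := he.equalizer (ρ a).continuous (ρ b).continuous h1
    exact congrFun this x
  refine ⟨LinearOrder.lift' F hF, fun a b c hbc => ?_⟩
  obtain ⟨k, hk, hlt⟩ : F b < F c := hbc
  refine (⟨k, fun j hj => ?_, ?_⟩ : F (a * b) < F (a * c))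
  · have : ρ b (e j) = ρ c (e j) := hk j hj
    change ρ (a * b) (e j) = ρ (a * c) (e j)
    rw [map_mul, map_mul, Homeomorph.mul_apply, Homeomorph.mul_apply, this]
  · have : ρ b (e k) < ρ c (e k) := hlt
    change ρ (a * b) (e k) < ρ (a * c) (e k)
    rw [map_mul, map_mul, Homeomorph.mul_apply, Homeomorph.mul_apply]
    exact hop a this

end Order

end RingGroup

theorem corollary1p5 (n : ℕ) (hn : 3 ≤ n) :
    ∃ (J : ZMod n → Set UnitAddCircle) (f : ZMod n → (UnitAddCircle ≃ₜ UnitAddCircle)),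
      LineAction.IsFastRing n J f ∧
      Group.FG (LineAction.ringDerivedGroup f) ∧
      IsSimpleGroup (LineAction.ringDerivedGroup f) ∧
      LineAction.IsLeftOrderable (LineAction.ringDerivedGroup f) ∧
      ∃ ρ : LineAction.ringDerivedGroup f →* (ℝ ≃ₜ ℝ), LineAction.IsTypeTwo ρ := by
  have : Fact (3 ≤ n) := ⟨hn⟩
  exact ⟨RingGroup.interval n, RingGroup.gen n, RingGroup.isFastRing_interval,
    RingGroup.fg_ringDerivedGroup, RingGroup.isSimpleGroup_ringDerivedGroup,
    RingGroup.isLeftOrderable_of_action (RingGroup.derivedLineAction n)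
      (RingGroup.lineAction_injective.comp Subtype.val_injective)
      RingGroup.isTypeTwo_derivedLineAction.1,
    RingGroup.derivedLineAction n, RingGroup.isTypeTwo_derivedLineAction⟩
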